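/- Let $n\ge 1$. The strip $\mathcal U_n=\mathbb R\times[0,1]$ has vertices $0^{(k)}$ ($k\in\mathbb Z$) on its upper boundary and $1^{(k)},\dots,n^{(k)}$ ($k\in\mathbb Z$) on its lower boundary, ordered from left to right by $k$ and then by the number, with $0^{(k)}$ above $1^{(k)},\dots,n^{(k)}$; put $(i+ln)^{(k)}=i^{(k+l)}$ for $l\in\mathbb Z$. An arc is an isotopy class of non-self-intersecting curves joining either two distinct, non-neighbouring lower vertices (peripheral arc), or a lower vertex $i^{(k)}$, $1\le i\le n$, to $0^{(k)}$ (bridging arc). A triangulation of $\mathcal U_n$ is a maximal set of pairwise non-crossing arcs. It is $n$-periodic if it consists of the horizontal translates, by all $k\mapsto k+l$, of its arcs lying in an $(n+3)$-gon bounded by two of its bridging arcs $0^{(k)}i^{(k)}$, $0^{(k+1)}i^{(k+1)}$ and by the boundary of the strip. Its triangles are the regions into which it divides the strip; a region with corners $i^{(k)},i'^{(k+1)},0^{(k)},0^{(k+1)}$ counts as a triangle whose upper corners are identified. Let $\mathcal T_n$ be an $n$-periodic triangulation of $\mathcal U_n$, and let $a_i$ ($i\in\mathbb Z$) be the number of triangles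 incident with $i^{(0)}$. An infinite frieze is an array $(m_{ij})_{i,j\in\mathbb Z,\,j-i\ge-2}$ with $m_{i,i-2}=0$, $m_{i,i-1}=1$, $m_{ij}$ a positive integer for $i\le j$, and $m_{ij}m_{i+1,j+1}-m_{i+1,j}m_{i,j+1}=1$ for $j-i\ge-1$. There is an infinite frieze $\mathcal F_{\mathcal T_n}=(m_{ij})$ with $m_{ii}=a_i$ for all $i$ (necessarily unique) that is $n$-periodic, i.e. $m_{ij}=m_{i+n,j+n}$ for $i\le j$, and $n$-arithmetic, i.e. for all $i\in\mathbb Z$ and $k\in\{1,\dots,n\}$ the sequence $(m_{i,\,i+k-3+ln})_{l\ge 0}$ is an arithmetic progression. For a lower vertex $v$, attach labels $n_v(w)\in\mathbb Z_{\ge0}$ to vertices $w$ as follows: $n_v(v)=0$; $n_v(w)=1$ for every $w$ joined to $v$ by a boundary segment or an arc of $\mathcal T_n$; as soon as one upper vertex has a label, all upper vertices get the same label; and, iteratively, whenever two of the three corners of a triangle of $\mathcal T_n$ are labelled and the third is not, the third gets the sum of the two labels. Then, for all $i,j,k\in\mathbb Z$ with $j-i\ge -2$, the label $n_{(i-1)^{(k)}}\big((j+1)^{(k)}\big)$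 is well defined (it is attached by some finite run of the procedure and is the same for all runs that attach it), and $$m_{ij}=n_{(i-1)^{(k)}}\big((j+1)^{(k)}\big).$$ -/

import Mathlib

/-- Vertices of the strip: `upper k` is the vertex `0^(k)` on the upper boundary; the vertices on
the lower boundary are numbered from left to right by the integers, `lower p` with
`p = i + k * n`, `1 ≤ i ≤ n`, being the vertex `i^(k)`. -/
inductive StripVertex : Type
  | upper (k : ℤ) : StripVertex
  | lower (p : ℤ) : StripVertex

/-- The lower vertex `i^(k)` of the strip `U_n`, with the convention
`(i + l n)^(k) = i^(k + l)` for all integers `i`, `k`, `l`. -/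
def lowerIndex (n : ℕ) (i k : ℤ) : ℤ := i + k * n

/-- The superscript `k` of the `p`-th lower vertex of `U_n`: `p = i + k * n` with `1 ≤ i ≤ n`
(floor division, for `1 ≤ n`). -/
def superscript (n : ℕ) (p : ℤ) : ℤ := (p - 1) / (n : ℤ)

/-- Arcs of the strip up to isotopy. A peripheral arc joins the lower vertices `p < q`, which are
neither equal nor neighbours. A bridging arc joins the lower vertex `p` to the upper vertex with
the same superscript, `0^(superscript n p)`, and so is determined by `p`. -/
inductive StripArc : Type
  | peripheral (p q : ℤ) (h : p + 2 ≤ q) : StripArc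
  | bridging (p : ℤ) : StripArc

/-- Two isotopy classes of arcs cross if representatives always meet in the interior of the strip:
two peripheral arcs if their endpoints interlace, a peripheral and a bridging arc if the lower end
of the latter lies strictly below the former. Two bridging arcs never cross, as the superscript is
monotone. -/
def StripArc.Crosses : StripArc → StripArc → Prop
  | .peripheral p q _, .peripheral p' q' _ =>
      (p < p' ∧ p' < q ∧ q < q') ∨ (p' < p ∧ p < q' ∧ q' < q)
  | .peripheral p q _, .bridging r => p < r ∧ r < q
  | .bridging r, .peripheral p q _ => p < r ∧ r < q
  | .bridging _, .bridging _ => False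

/-- A triangulation of the strip: a maximal collection of pairwise non-crossing arcs. -/
def IsStripTriangulation (T : Set StripArc) : Prop :=
  Maximal (fun S : Set StripArc => S.Pairwise fun a b => ¬ a.Crosses b) T

/-- Horizontal translation of an arc by `d` lower vertices. For `d` a multiple `l * n` of `n`
this moves `i^(k)` to `i^(k + l)` and `0^(k)` to `0^(k + l)`. -/
def StripArc.translate (d : ℤ) : StripArc → StripArc
  | .peripheral p q h => .peripheral (p + d) (q + d) (by omega)
  | .bridging p => .bridging (p + d)

/-- The arc lies in the `(n + 3)`-gon (sides included) whose lower vertices are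
`p, p + 1, …, p + n` and whose upper vertices are `0^(k)` and `0^(k + 1)`,
`k = superscript n p`. -/
def StripArc.InPolygon (n : ℕ) (p : ℤ) : StripArc → Prop
  | .peripheral x y _ => p ≤ x ∧ y ≤ p + n
  | .bridging x => p ≤ x ∧ x ≤ p + n

/-- `T` is `n`-periodic: it contains the two bridging sides of an `(n + 3)`-gon (the fundamental
domain) such that `T` consists of the translates, by multiples of `n`, of the arcs of `T` in
this polygon. -/
def IsPeriodicStripTriangulation (n : ℕ) (T : Set StripArc) : Prop :=
  IsStripTriangulation T ∧
  ∃ p : ℤ, StripArc.bridging p ∈ T ∧ StripArc.bridging (p + n) ∈ T ∧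
    ∀ a : StripArc, a ∈ T ↔
      ∃ b ∈ T, ∃ l : ℤ, b.InPolygon n p ∧ a = b.translate (l * n)

/-- The lower vertices `p < q` are joined by a boundary segment or by an arc of `T`. -/
def IsSide (T : Set StripArc) (p q : ℤ) : Prop :=
  q = p + 1 ∨ ∃ h : p + 2 ≤ q, StripArc.peripheral p q h ∈ T

/-- Names for triangles: `inner p q r` has the three lower vertices `p < q < r`; `outer p q` is
bounded by the two bridging arcs at `p < q`, by the side from `p` to `q`, and by the part of the
upper boundary between the upper ends of the two bridging arcs. The latter has three sides if these
upper ends agree and four sides if they are the neighbours `0^(k)`, `0^(k + 1)`. -/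
inductive StripTriangle : Type
  | inner (p q r : ℤ) : StripTriangle
  | outer (p q : ℤ) : StripTriangle

/-- The triangles of `T`, that is, the regions into which `T` divides the strip. -/
def IsTriangleOf (T : Set StripArc) : StripTriangle → Prop
  | .inner p q r => IsSide T p q ∧ IsSide T q r ∧ IsSide T p r
  | .outer p q => IsSide T p q ∧ StripArc.bridging p ∈ T ∧ StripArc.bridging q ∈ T

/-- The triangle is incident with the lower vertex `x`. -/
def StripTriangle.Incident (x : ℤ) : StripTriangle → Prop
  | .inner p q r => x = p ∨ x = q ∨ x = r
  | .outer p q => x = p ∨ x = q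

/-- The number of triangles of `T` that are incident with the lower vertex `x`. -/
noncomputable def stripQuiddity (T : Set StripArc) (x : ℤ) : ℕ :=
  {τ : StripTriangle | IsTriangleOf T τ ∧ τ.Incident x}.ncard

/-- Infinite friezes `(m i j)`, `j - i ≥ -2`. The values `m i j` for `j < i - 2` carry no
meaning. -/
structure IsInfiniteFrieze (m : ℤ → ℤ → ℕ) : Prop where
  row_zero : ∀ i : ℤ, m i (i - 2) = 0
  row_one : ∀ i : ℤ, m i (i - 1) = 1
  pos : ∀ i j : ℤ, i ≤ j → 0 < m i j
  unimodular : ∀ i j : ℤ, i - 1 ≤ j →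
    (m i j : ℤ) * m (i + 1) (j + 1) - (m (i + 1) j : ℤ) * m i (j + 1) = 1

/-- The frieze is `n`-periodic. -/
def IsPeriodicFrieze (n : ℕ) (m : ℤ → ℤ → ℕ) : Prop :=
  ∀ i j : ℤ, i ≤ j → m i j = m (i + n) (j + n)

/-- The frieze is `r`-arithmetic: for `k ∈ {1, …, r}`, the entries
`m i (i + k - 3 + l * r)`, `l ≥ 0`, form an arithmetic progression. -/
def IsArithmeticFrieze (r : ℕ) (m : ℤ → ℤ → ℕ) : Prop :=
  ∀ i k : ℤ, 1 ≤ k → k ≤ r → ∀ l : ℕ,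
    (m i ((i + k - 3) + (l + 1) * r) : ℤ) - m i ((i + k - 3) + l * r) =
      (m i ((i + k - 3) + r) : ℤ) - m i (i + k - 3)

/-- `m` is the infinite frieze associated to `T`: its quiddity row is that of `T`. -/
def IsFriezeOfTriangulation (T : Set StripArc) (m : ℤ → ℤ → ℕ) : Prop :=
  IsInfiniteFrieze m ∧ ∀ i : ℤ, m i i = stripQuiddity T i

/-- Equality of vertices after all upper vertices have been identified with each other. -/
def StripVertex.Same : StripVertex → StripVertex → Prop
  | .upper _, .upper _ => True
  | .lower p, .lower q => p = q
  | _, _ => False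

/-- The vertex is joined to the lower vertex `v` by a boundary segment or an arc of `T`. -/
def IsJoined (n : ℕ) (T : Set StripArc) (v : ℤ) : StripVertex → Prop
  | .lower q => IsSide T v q ∨ IsSide T q v
  | .upper k => StripArc.bridging v ∈ T ∧ k = superscript n v

open Classical in
/-- The labels given first: `0` to the starting vertex `v`, and `1` to every vertex joined to `v`
and, if an upper vertex is among these, to all upper vertices. -/
noncomputable def initialLabels (n : ℕ) (T : Set StripArc) (v : ℤ) (w : StripVertex) : Option ℕ :=
  if w = .lower v then some 0
  else if ∃ w', w.Same w' ∧ IsJoined n T v w' then some 1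
  else none

open Classical in
/-- Attach the label `c` to `z`; if `z` is an upper vertex, to all upper vertices. -/
noncomputable def attachLabel (f : StripVertex → Option ℕ) (z : StripVertex) (c : ℕ) :
    StripVertex → Option ℕ :=
  fun w => if w.Same z then some c else f w

/-- The three corners of a triangle. The upper corners of a four-sided triangle count as one; as
they always have the same label, it does not matter which of them is listed. -/
def StripTriangle.corner (n : ℕ) : StripTriangle → Fin 3 → StripVertex
  | .inner p q r => ![.lower p, .lower q, .lower r]
  | .outer p q => ![.lower p, .lower q, .upper (superscript n p)]

/-- The partial labellings that occur during the labelling procedure with starting vertex the lower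
vertex `v`: whenever two of the three corners of a triangle of `T` are labelled and the third
is not, the third may receive the sum of the two labels. -/
inductive IsPartialLabelling (n : ℕ) (T : Set StripArc) (v : ℤ) :
    (StripVertex → Option ℕ) → Prop
  | start : IsPartialLabelling n T v (initialLabels n T v)
  | step (f : StripVertex → Option ℕ) (hf : IsPartialLabelling n T v f)
      (τ : StripTriangle) (hτ : IsTriangleOf T τ) (σ : Equiv.Perm (Fin 3)) (a b : ℕ)
      (ha : f (τ.corner n (σ 0)) = some a) (hb : f (τ.corner n (σ 1)) = some b)
      (hc : f (τ.corner n (σ 2)) = none) :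
      IsPartialLabelling n T v (attachLabel f (τ.corner n (σ 2)) (a + b))

/-- The labelling procedure with starting vertex `v` can attach the label `a` to `w`. Thus
`n_v(w)` is the number `a` with this property, if there is exactly one. -/
def HasLabel (n : ℕ) (T : Set StripArc) (v : ℤ) (w : StripVertex) (a : ℕ) : Prop :=
  ∃ f : StripVertex → Option ℕ, IsPartialLabelling n T v f ∧ f w = some a

/-! Everything is read off from the solutions of the linear recurrence `u (p + 1) + u (p - 1) = a p
* u p`, where `a p` counts the triangles at `p`. Counting the fans of triangles at the ends of a
side shows that every solution is additive on triangles: at an inner triangle the value at the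
middle corner is the sum of the values at the other two (`apply_mid`), and along consecutive
bridging vertices the values form an arithmetic progression (`apply_outer`).

Hence there are solutions `x`, `y` with Wronskian 1 such that `y` is 1 at the bridging vertices and
`x` grows by 1 across each outer triangle (`exists_isVertexCoordinates`). With the vector `(y p, x
p)` at the lower vertex `p` and `(0, 1)` at the upper vertices, the frieze entry at `(i, j)` is the
determinant of the vectors at `i - 1` and `j + 1`. The Plücker relation gives the unimodular rule; a
translation by `n` is a shear fixing `(0, 1)`, which gives periodicity and the arithmetic
progressions.

The labels are these determinants up to sign. Additivity of vectors becomes additivity of absolute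
values when the new corner of a triangle is the one facing away from `v`. This always happens,
because the labelled set stays closed towards `v` (`IsClosedTowards`): no arc is passed before its
ends are labelled. -/

/-! ### Sides and the triangulated polygons below them -/

theorem StripArc.Crosses.symm {a b : StripArc} (h : a.Crosses b) : b.Crosses a := by
  cases a <;> cases b <;> simp only [StripArc.Crosses] at h ⊢ <;> omega

theorem StripArc.not_crosses_self (a : StripArc) : ¬ a.Crosses a := by
  rcases a with ⟨p, q, h⟩ | p <;> simp only [StripArc.Crosses, not_false_eq_true]
  omega

theorem IsStripTriangulation.not_crosses {T : Set StripArc} (hT : IsStripTriangulation T)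
    {a b : StripArc} (ha : a ∈ T) (hb : b ∈ T) : ¬ a.Crosses b := by
  by_cases h : a = b
  · exact h ▸ a.not_crosses_self
  · exact hT.1 ha hb h

theorem IsStripTriangulation.mem_of_forall_not_crosses {T : Set StripArc}
    (hT : IsStripTriangulation T) {a : StripArc} (ha : ∀ b ∈ T, ¬ a.Crosses b) : a ∈ T := by
  have h : (insert a T).Pairwise fun a b => ¬ a.Crosses b := by
    refine hT.1.insert fun b hb _ => ⟨ha b hb, fun h => ha b hb h.symm⟩
  exact hT.2 h (Set.subset_insert a T) (Set.mem_insert a T)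

theorem IsSide.lt {T : Set StripArc} {p q : ℤ} (h : IsSide T p q) : p < q := by
  rcases h with h | ⟨h, -⟩ <;> omega

theorem isSide_succ (T : Set StripArc) (p : ℤ) : IsSide T p (p + 1) := Or.inl rfl

theorem IsStripTriangulation.le_of_isSide {T : Set StripArc} (hT : IsStripTriangulation T)
    {p q a b : ℤ} (h : IsSide T p q) (h' : IsSide T a b) (hpa : p < a) (haq : a < q) :
    b ≤ q := by
  rcases h with h | ⟨_, h⟩
  · omega
  rcases h' with h' | ⟨_, h'⟩
  · omega
  have := hT.not_crosses h h'
  simp only [StripArc.Crosses] at this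
  omega

theorem IsStripTriangulation.not_bridging_of_isSide {T : Set StripArc}
    (hT : IsStripTriangulation T) {p q r : ℤ} (h : IsSide T p q)
    (hr : StripArc.bridging r ∈ T) : ¬ (p < r ∧ r < q) := by
  rcases h with h | ⟨_, h⟩
  · omega
  · exact hT.not_crosses h hr

/-- The region of a triangulation directly below a peripheral arc is a triangle. -/
theorem IsStripTriangulation.exists_apex {T : Set StripArc} (hT : IsStripTriangulation T)
    {p q : ℤ} (h : IsSide T p q) (hpq : p + 2 ≤ q) :
    ∃ r, p < r ∧ r < q ∧ IsSide T p r ∧ IsSide T r q := by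
  -- The apex is the rightmost vertex before `q` joined to `p`. An arc crossing the chord from `r`
  -- to `q` would cross one of the sides `p q`, `p r`, or would start at `p` and contradict this
  -- choice.
  obtain ⟨r, ⟨hrq, hpr⟩, hmax⟩ := Int.exists_greatest_of_bdd
    (P := fun r => r < q ∧ IsSide T p r) ⟨q, fun z hz => hz.1.le⟩
    ⟨p + 1, by omega, isSide_succ T p⟩
  refine ⟨r, hpr.lt, hrq, hpr, ?_⟩
  by_cases hr : r + 2 ≤ q
  · refine Or.inr ⟨hr, hT.mem_of_forall_not_crosses ?_⟩
    have hlt := hpr.lt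
    rintro (⟨a, b, hab⟩ | x) hb
    · have hs : IsSide T a b := Or.inr ⟨hab, hb⟩
      have h1 := hT.le_of_isSide h hs
      have h2 := hT.le_of_isSide hs h
      have h3 := hT.le_of_isSide hpr hs
      have h4 : a = p → b < q → b ≤ r := by
        rintro rfl hbq
        exact hmax b ⟨hbq, hs⟩
      simp only [StripArc.Crosses]
      omega
    · have := hT.not_bridging_of_isSide h hb
      simp only [StripArc.Crosses]
      omega
  · exact Or.inl (by omega)

/-- A peripheral arc interlacing with the chord from `p` to `q` would pass over `p` or `q` and so
cross a bridging arc; maximality then puts the chord in `T`. -/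
theorem IsStripTriangulation.isSide_of_bridging {T : Set StripArc} (hT : IsStripTriangulation T)
    {p q : ℤ} (hpq : p < q) (hp : StripArc.bridging p ∈ T) (hq : StripArc.bridging q ∈ T)
    (h : ∀ r, p < r → r < q → StripArc.bridging r ∉ T) : IsSide T p q := by
  by_cases hr : p + 2 ≤ q
  · refine Or.inr ⟨hr, hT.mem_of_forall_not_crosses ?_⟩
    rintro (⟨a, b, hab⟩ | x) hb
    · have hs : IsSide T a b := Or.inr ⟨hab, hb⟩
      have h1 := hT.not_bridging_of_isSide hs hp
      have h2 := hT.not_bridging_of_isSide hs hq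
      simp only [StripArc.Crosses]
      omega
    · have := h x
      simp only [StripArc.Crosses]
      tauto
  · exact Or.inl (by omega)

/-- Removing the apex triangle from the polygon below a side leaves the polygons below two shorter
sides. -/
theorem IsStripTriangulation.isSide_induction {T : Set StripArc} (hT : IsStripTriangulation T)
    {Q : ℤ → ℤ → Prop} (succ : ∀ p, Q p (p + 1))
    (apex : ∀ p r q, IsSide T p q → IsSide T p r → IsSide T r q → Q p r → Q r q → Q p q)
    {p q : ℤ} (h : IsSide T p q) : Q p q := by
  obtain ⟨d, hd⟩ : ∃ d : ℕ, q - p ≤ d := ⟨(q - p).toNat, by omega⟩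
  induction d generalizing p q with
  | zero => have := h.lt; omega
  | succ d ih =>
    by_cases hpq : p + 2 ≤ q
    · obtain ⟨r, h1, h2, h3, h4⟩ := hT.exists_apex h hpq
      exact apex p r q h h3 h4 (ih h3 (by omega)) (ih h4 (by omega))
    · obtain rfl : q = p + 1 := by have := h.lt; omega
      exact succ p

/-! ### Counting the triangles at a vertex -/

/-- Triangles with three lower corners in `[p, q]` that are incident with `x`. -/
def innerTriangles (T : Set StripArc) (p q x : ℤ) : Set StripTriangle :=
  {τ | ∃ a b c, τ = .inner a b c ∧ IsTriangleOf T τ ∧ τ.Incident x ∧ p ≤ a ∧ c ≤ q}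

theorem innerTriangles_eq_empty (T : Set StripArc) {p q x : ℤ}
    (h : q ≤ p + 1 ∨ x < p ∨ q < x) : innerTriangles T p q x = ∅ := by
  ext τ
  simp only [innerTriangles, Set.mem_ofPred_eq, Set.mem_empty_iff_false, iff_false]
  rintro ⟨a, b, c, rfl, ⟨h1, h2, -⟩, h3, h4, h5⟩
  have := h1.lt
  have := h2.lt
  simp only [StripTriangle.Incident] at h3
  omega

theorem IsStripTriangulation.innerTriangles_eq {T : Set StripArc} (hT : IsStripTriangulation T)
    {p r q : ℤ} (hpq : IsSide T p q) (hpr : IsSide T p r) (hrq : IsSide T r q) (x : ℤ) :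
    innerTriangles T p q x = innerTriangles T p r x ∪ innerTriangles T r q x ∪
      {τ | τ = .inner p r q ∧ τ.Incident x} := by
  have l1 := hpr.lt
  have l2 := hrq.lt
  ext τ
  simp only [innerTriangles, Set.mem_ofPred_eq, Set.mem_union]
  constructor
  · rintro ⟨a, b, c, rfl, h, h3, h4, h5⟩
    obtain ⟨hab, hbc, hac⟩ := h
    have m1 := hab.lt
    have m2 := hbc.lt
    have n1 := hT.le_of_isSide hpr hac
    have n2 := hT.le_of_isSide hac hrq
    have n3 := hT.le_of_isSide hab hrq
    have n4 := hT.le_of_isSide hpr hbc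
    by_cases hc : c ≤ r
    · exact Or.inl (Or.inl ⟨a, b, c, rfl, ⟨hab, hbc, hac⟩, h3, h4, hc⟩)
    by_cases ha : r ≤ a
    · exact Or.inl (Or.inr ⟨a, b, c, rfl, ⟨hab, hbc, hac⟩, h3, ha, h5⟩)
    obtain ⟨rfl, rfl, rfl⟩ : a = p ∧ b = r ∧ c = q := by omega
    exact Or.inr ⟨rfl, h3⟩
  · rintro ((⟨a, b, c, rfl, h, h3, h4, h5⟩ | ⟨a, b, c, rfl, h, h3, h4, h5⟩) | ⟨rfl, h⟩)
    · exact ⟨a, b, c, rfl, h, h3, h4, by omega⟩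
    · exact ⟨a, b, c, rfl, h, h3, by omega, h5⟩
    · exact ⟨p, r, q, rfl, ⟨hpr, hrq, hpq⟩, h, le_rfl, le_rfl⟩

theorem IsStripTriangulation.finite_innerTriangles {T : Set StripArc}
    (hT : IsStripTriangulation T) {p q : ℤ} (h : IsSide T p q) (x : ℤ) :
    (innerTriangles T p q x).Finite := by
  refine hT.isSide_induction (Q := fun p q => (innerTriangles T p q x).Finite) ?_ ?_ h
  · intro p
    rw [innerTriangles_eq_empty T (Or.inl le_rfl)]
    exact Set.finite_empty
  · intro p r q h1 h2 h3 h4 h5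
    rw [hT.innerTriangles_eq h1 h2 h3]
    exact (h4.union h5).union ((Set.finite_singleton (StripTriangle.inner p r q)).subset
      fun τ h => h.1)

theorem disjoint_innerTriangles (T : Set StripArc) (p r q x : ℤ) :
    Disjoint (innerTriangles T p r x) (innerTriangles T r q x) := by
  rw [Set.disjoint_left]
  rintro τ ⟨a, b, c, rfl, h, h3, h4, h5⟩ ⟨a', b', c', e, -, -, h4', h5'⟩
  injection e with e1 e2 e3
  have := h.1.lt
  have := h.2.1.lt
  omega

theorem IsStripTriangulation.ncard_innerTriangles {T : Set StripArc}
    (hT : IsStripTriangulation T) {p r q : ℤ} (hpq : IsSide T p q) (hpr : IsSide T p r)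
    (hrq : IsSide T r q) {x : ℤ} (hx : x = p ∨ x = r ∨ x = q) :
    (innerTriangles T p q x).ncard =
      (innerTriangles T p r x).ncard + (innerTriangles T r q x).ncard + 1 := by
  have e : {τ | τ = StripTriangle.inner p r q ∧ τ.Incident x} = {StripTriangle.inner p r q} := by
    ext τ
    simp only [Set.mem_ofPred_eq, Set.mem_singleton_iff, and_iff_left_iff_imp]
    rintro rfl
    exact hx
  have l1 := hpr.lt
  have l2 := hrq.lt
  rw [hT.innerTriangles_eq hpq hpr hrq, e, Set.union_singleton, Set.ncard_insert_of_notMem ?_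
      ((hT.finite_innerTriangles hpr x).union (hT.finite_innerTriangles hrq x)),
    Set.ncard_union_eq (disjoint_innerTriangles T p r q x) (hT.finite_innerTriangles hpr x)
      (hT.finite_innerTriangles hrq x)]
  · rintro (⟨a, b, c, e, -, -, h4, h5⟩ | ⟨a, b, c, e, -, -, h4, h5⟩) <;>
    · injection e with e1 e2 e3
      omega

theorem IsStripTriangulation.stripQuiddity_eq_of_isSide {T : Set StripArc}
    (hT : IsStripTriangulation T) {p q x : ℤ} (h : IsSide T p q) (hpx : p < x) (hxq : x < q) :
    stripQuiddity T x = (innerTriangles T p q x).ncard := by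
  unfold stripQuiddity
  congr 1
  ext τ
  simp only [innerTriangles, Set.mem_ofPred_eq]
  constructor
  · rintro ⟨hτ, hx⟩
    rcases τ with ⟨a, b, c⟩ | ⟨a, b⟩
    · refine ⟨a, b, c, rfl, hτ, hx, ?_⟩
      obtain ⟨hab, hbc, hac⟩ := hτ
      simp only [StripTriangle.Incident] at hx
      have l1 := hab.lt
      have l2 := hbc.lt
      have n1 := hT.le_of_isSide h hac
      have n2 := hT.le_of_isSide hac h
      have n3 := hT.le_of_isSide h hab
      have n4 := hT.le_of_isSide hab h
      have n5 := hT.le_of_isSide h hbc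
      have n6 := hT.le_of_isSide hbc h
      omega
    · obtain ⟨-, h1, h2⟩ := hτ
      have n1 := hT.not_bridging_of_isSide h h1
      have n2 := hT.not_bridging_of_isSide h h2
      simp only [StripTriangle.Incident] at hx
      omega
  · rintro ⟨a, b, c, rfl, h1, h2, -⟩
    exact ⟨h1, h2⟩

/-- No side passes over an end of a bridging arc, so the inner triangles at `x` split into those on
its left and those on its right; the summand 2 counts the two outer triangles. -/
theorem IsStripTriangulation.stripQuiddity_eq_of_bridging {T : Set StripArc}
    (hT : IsStripTriangulation T) {p x q : ℤ} (h : IsTriangleOf T (.outer p x))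
    (h' : IsTriangleOf T (.outer x q)) :
    stripQuiddity T x = (innerTriangles T p x x).ncard + (innerTriangles T x q x).ncard + 2 := by
  have e : {τ | IsTriangleOf T τ ∧ τ.Incident x} = insert (.outer p x) (insert (.outer x q)
      (innerTriangles T p x x ∪ innerTriangles T x q x)) := by
    have k1 := h.1.lt
    have k2 := h'.1.lt
    ext τ
    simp only [innerTriangles, Set.mem_ofPred_eq, Set.mem_insert_iff, Set.mem_union]
    constructor
    · rintro ⟨hτ, hx⟩
      rcases τ with ⟨a, b, c⟩ | ⟨a, b⟩
      · obtain ⟨hab, hbc, hac⟩ := hτ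
        have l1 := hab.lt
        have l2 := hbc.lt
        have n1 := hT.not_bridging_of_isSide hac h.2.1
        have n2 := hT.not_bridging_of_isSide hac h.2.2
        have n3 := hT.not_bridging_of_isSide hac h'.2.2
        have hx' := hx
        simp only [StripTriangle.Incident] at hx'
        have : x = c ∧ p ≤ a ∨ x = a ∧ c ≤ q := by omega
        rcases this with h3 | h3
        · exact Or.inr (Or.inr (Or.inl
            ⟨a, b, c, rfl, ⟨hab, hbc, hac⟩, hx, h3.2, h3.1.ge⟩))
        · exact Or.inr (Or.inr (Or.inr
            ⟨a, b, c, rfl, ⟨hab, hbc, hac⟩, hx, h3.1.le, h3.2⟩))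
      · obtain ⟨hab, ha, hb⟩ := hτ
        have l1 := hab.lt
        have n1 := hT.not_bridging_of_isSide hab h.2.1
        have n2 := hT.not_bridging_of_isSide hab h'.2.2
        have n3 := hT.not_bridging_of_isSide h.1 ha
        have n4 := hT.not_bridging_of_isSide h'.1 hb
        simp only [StripTriangle.Incident] at hx
        have : (a = p ∧ b = x) ∨ (a = x ∧ b = q) := by omega
        rcases this with ⟨rfl, rfl⟩ | ⟨rfl, rfl⟩ <;> simp
    · rintro (rfl | rfl | ⟨a, b, c, rfl, h1, h2, -⟩ | ⟨a, b, c, rfl, h1, h2, -⟩)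
      · exact ⟨h, Or.inr rfl⟩
      · exact ⟨h', Or.inl rfl⟩
      · exact ⟨h1, h2⟩
      · exact ⟨h1, h2⟩
  have fin := (hT.finite_innerTriangles h.1 x).union (hT.finite_innerTriangles h'.1 x)
  have hno : ∀ a b, StripTriangle.outer a b ∉
      innerTriangles T p x x ∪ innerTriangles T x q x := by
    rintro a b (⟨_, _, _, e, -⟩ | ⟨_, _, _, e, -⟩) <;> cases e
  unfold stripQuiddity
  rw [e, Set.ncard_insert_of_notMem ?_ (fin.insert _), Set.ncard_insert_of_notMem (hno _ _) fin,
    Set.ncard_union_eq (disjoint_innerTriangles T p x q x) (hT.finite_innerTriangles h.1 x)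
      (hT.finite_innerTriangles h'.1 x)]
  · rintro (e | e)
    · injection e with e1 e2
      exact h.1.lt.ne e1
    · exact hno _ _ e

/-! ### Periodicity and the chain of outer triangles -/

theorem StripArc.translate_translate (a : StripArc) (d e : ℤ) :
    (a.translate d).translate e = a.translate (d + e) := by
  cases a <;> simp [StripArc.translate, add_assoc]

theorem StripArc.translate_zero (a : StripArc) : a.translate 0 = a := by
  cases a <;> simp [StripArc.translate]

theorem IsPeriodicStripTriangulation.translate_mem {n : ℕ} {T : Set StripArc}
    (hT : IsPeriodicStripTriangulation n T) {a : StripArc} (ha : a ∈ T) (l : ℤ) :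
    a.translate (l * n) ∈ T := by
  obtain ⟨-, p, -, -, h⟩ := hT
  obtain ⟨b, hb, k, hk, rfl⟩ := (h a).1 ha
  refine (h _).2 ⟨b, hb, k + l, hk, ?_⟩
  rw [StripArc.translate_translate, add_mul]

theorem IsPeriodicStripTriangulation.translate_mem_iff {n : ℕ} {T : Set StripArc}
    (hT : IsPeriodicStripTriangulation n T) (a : StripArc) :
    a.translate n ∈ T ↔ a ∈ T := by
  constructor
  · intro h
    have := hT.translate_mem h (-1)
    rwa [StripArc.translate_translate, neg_one_mul, add_neg_cancel,
      StripArc.translate_zero] at this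
  · intro h
    simpa using hT.translate_mem h 1

theorem IsPeriodicStripTriangulation.isSide_add_iff {n : ℕ} {T : Set StripArc}
    (hT : IsPeriodicStripTriangulation n T) (p q : ℤ) :
    IsSide T (p + n) (q + n) ↔ IsSide T p q := by
  refine or_congr (by omega) ⟨?_, ?_⟩
  · rintro ⟨h, h'⟩
    have h2 : p + 2 ≤ q := by omega
    exact ⟨h2, (hT.translate_mem_iff (.peripheral p q h2)).1 h'⟩
  · rintro ⟨h, h'⟩
    exact ⟨by omega, (hT.translate_mem_iff (.peripheral p q h)).2 h'⟩

theorem IsPeriodicStripTriangulation.bridging_add_iff {n : ℕ} {T : Set StripArc}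
    (hT : IsPeriodicStripTriangulation n T) (p : ℤ) :
    StripArc.bridging (p + n) ∈ T ↔ StripArc.bridging p ∈ T :=
  hT.translate_mem_iff (.bridging p)

/-- Horizontal translation of a triangle. -/
def StripTriangle.translate (d : ℤ) : StripTriangle → StripTriangle
  | .inner p q r => .inner (p + d) (q + d) (r + d)
  | .outer p q => .outer (p + d) (q + d)

theorem StripTriangle.translate_injective (d : ℤ) :
    Function.Injective (StripTriangle.translate d) := by
  intro a b h
  cases a <;> cases b <;> simp [StripTriangle.translate] at h <;> simp [h]

theorem IsPeriodicStripTriangulation.isTriangleOf_translate_iff {n : ℕ} {T : Set StripArc}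
    (hT : IsPeriodicStripTriangulation n T) (τ : StripTriangle) :
    IsTriangleOf T (τ.translate n) ↔ IsTriangleOf T τ := by
  cases τ <;> simp [StripTriangle.translate, IsTriangleOf, hT.isSide_add_iff,
    hT.bridging_add_iff]

theorem IsPeriodicStripTriangulation.stripQuiddity_add {n : ℕ} {T : Set StripArc}
    (hT : IsPeriodicStripTriangulation n T) (x : ℤ) :
    stripQuiddity T (x + n) = stripQuiddity T x := by
  have hinc : ∀ τ : StripTriangle, (τ.translate n).Incident (x + n) ↔ τ.Incident x := by
    intro τ
    cases τ <;> simp [StripTriangle.translate, StripTriangle.Incident]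
  unfold stripQuiddity
  rw [← Set.ncard_image_of_injective {τ | IsTriangleOf T τ ∧ τ.Incident x}
    (StripTriangle.translate_injective n)]
  congr 1
  ext τ
  simp only [Set.mem_ofPred_eq, Set.mem_image]
  constructor
  · rintro ⟨h1, h2⟩
    obtain ⟨σ, rfl⟩ : ∃ σ : StripTriangle, σ.translate n = τ := by
      rcases τ with ⟨a, b, c⟩ | ⟨a, b⟩
      · exact ⟨.inner (a - n) (b - n) (c - n), by simp [StripTriangle.translate]⟩
      · exact ⟨.outer (a - n) (b - n), by simp [StripTriangle.translate]⟩
    exact ⟨σ, ⟨(hT.isTriangleOf_translate_iff σ).1 h1, (hinc σ).1 h2⟩, rfl⟩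
  · rintro ⟨σ, ⟨h1, h2⟩, rfl⟩
    exact ⟨(hT.isTriangleOf_translate_iff σ).2 h1, (hinc σ).2 h2⟩

theorem IsPeriodicStripTriangulation.exists_outer {n : ℕ} (hn : 1 ≤ n) {T : Set StripArc}
    (hT : IsPeriodicStripTriangulation n T) (x : ℤ) :
    ∃ p q, p ≤ x ∧ x < q ∧ IsTriangleOf T (.outer p q) := by
  obtain ⟨c, hc, -⟩ := hT.2
  have hcl : ∀ l : ℤ, StripArc.bridging (c + l * n) ∈ T := fun l => hT.translate_mem hc l
  have hn' : (1 : ℤ) ≤ n := by exact_mod_cast hn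
  obtain ⟨p, ⟨hpx, hp⟩, hpm⟩ := Int.exists_greatest_of_bdd
    (P := fun p => p ≤ x ∧ StripArc.bridging p ∈ T) ⟨x, fun z hz => hz.1⟩
    -- As `n ≥ 1`, moving `c` by `|c - x|` periods to the left, or by one more than that to the
    -- right, passes `x`.
    ⟨_, by nlinarith [abs_nonneg (c - x), le_abs_self (c - x)], hcl (-|c - x|)⟩
  obtain ⟨q, ⟨hxq, hq⟩, hqm⟩ := Int.exists_least_of_bdd
    (P := fun p => x < p ∧ StripArc.bridging p ∈ T) ⟨x, fun z hz => hz.1.le⟩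
    ⟨_, by nlinarith [abs_nonneg (c - x), neg_abs_le (c - x)], hcl (|c - x| + 1)⟩
  refine ⟨p, q, hpx, hxq, hT.1.isSide_of_bridging (by omega) hp hq ?_, hp, hq⟩
  intro r h1 h2 hr
  by_cases h : r ≤ x
  · have := hpm r ⟨h, hr⟩
    omega
  · have := hqm r ⟨by omega, hr⟩
    omega

/-- The outer triangles form a chain that is unbounded on both sides. -/
theorem IsPeriodicStripTriangulation.outer_induction {n : ℕ} (hn : 1 ≤ n) {T : Set StripArc}
    (hT : IsPeriodicStripTriangulation n T) {Q : ℤ → ℤ → Prop} {p₀ q₀ : ℤ}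
    (h₀ : IsTriangleOf T (.outer p₀ q₀)) (base : Q p₀ q₀)
    (right : ∀ p q r, IsTriangleOf T (.outer p q) → IsTriangleOf T (.outer q r) →
      Q p q → Q q r)
    (left : ∀ p q r, IsTriangleOf T (.outer p q) → IsTriangleOf T (.outer q r) →
      Q q r → Q p q)
    {p q : ℤ} (h : IsTriangleOf T (.outer p q)) : Q p q := by
  have l₀ := h₀.1.lt
  obtain ⟨d, hd⟩ : ∃ d : ℕ, (p - p₀).natAbs = d := ⟨_, rfl⟩
  induction d using Nat.strong_induction_on generalizing p q with
  | _ d ih =>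
    have l := h.1.lt
    have n1 := hT.1.not_bridging_of_isSide h.1 h₀.2.1
    have n2 := hT.1.not_bridging_of_isSide h.1 h₀.2.2
    have n3 := hT.1.not_bridging_of_isSide h₀.1 h.2.1
    have n4 := hT.1.not_bridging_of_isSide h₀.1 h.2.2
    rcases lt_trichotomy p p₀ with hp | rfl | hp
    · obtain ⟨q', r, h1, h2, h3⟩ := hT.exists_outer hn q
      have n5 := hT.1.not_bridging_of_isSide h3.1 h.2.2
      obtain rfl : q' = q := by omega
      exact left _ _ _ h h3 (ih (q' - p₀).natAbs (by omega) h3 rfl)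
    · obtain rfl : q = q₀ := by omega
      exact base
    · obtain ⟨p', p'', h1, h2, h3⟩ := hT.exists_outer hn (p - 1)
      have n5 := hT.1.not_bridging_of_isSide h3.1 h.2.1
      have n6 := hT.1.not_bridging_of_isSide h3.1 h₀.2.1
      obtain rfl : p'' = p := by omega
      exact right _ _ _ h3 h (ih (p' - p₀).natAbs (by omega) h3 rfl)

/-! ### Solutions of the quiddity recurrence -/

theorem exists_solution_recurrence (a : ℤ → ℤ) (c α β : ℤ) :
    ∃ u : ℤ → ℤ, u c = α ∧ u (c + 1) = β ∧ ∀ p, u (p + 1) + u (p - 1) = a p * u p := by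
  -- The state at `p` is the pair `(u p, u (p + 1))`; the recurrence can be run backwards over the
  -- integers since `u (p - 1)` has coefficient 1.
  let g : ℤ → ℤ × ℤ := fun p => Int.inductionOn' (motive := fun _ => ℤ × ℤ) p c (α, β)
    (fun k _ s => (s.2, a (k + 1) * s.2 - s.1)) (fun k _ s => (a k * s.1 - s.2, s.1))
  have g0 : g c = (α, β) := Int.inductionOn'_self
  have g1 : ∀ p, g (p + 1) = ((g p).2, a (p + 1) * (g p).2 - (g p).1) := by
    intro p
    rcases le_or_gt c p with h | h
    · exact Int.inductionOn'_add_one h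
    · have := Int.inductionOn'_sub_one (motive := fun _ => ℤ × ℤ) (b := c) (zero := (α, β))
        (succ := fun k _ s => (s.2, a (k + 1) * s.2 - s.1))
        (pred := fun k _ s => (a k * s.1 - s.2, s.1)) (z := p + 1) (by omega)
      have e : g p = (a (p + 1) * (g (p + 1)).1 - (g (p + 1)).2, (g (p + 1)).1) := by
        rw [← this, add_sub_cancel_right]
      rw [e]
      ext <;> simp
  refine ⟨fun p => (g p).1, by simp [g0], by simp [g1, g0], fun p => ?_⟩
  have h1 := g1 p
  have h2 := g1 (p - 1)
  rw [sub_add_cancel] at h2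
  simp only [h1]
  rw [h2]
  simp

theorem eq_zero_of_recurrence {a u : ℤ → ℤ} (hu : ∀ p, u (p + 1) + u (p - 1) = a p * u p)
    {c : ℤ} (h0 : u c = 0) (h1 : u (c + 1) = 0) (p : ℤ) : u p = 0 := by
  suffices h : u p = 0 ∧ u (p + 1) = 0 from h.1
  induction p using Int.inductionOn' (b := c) with
  | zero => exact ⟨h0, h1⟩
  | succ k _ ih =>
    have := hu (k + 1)
    rw [add_sub_cancel_right, ih.1, ih.2] at this
    exact ⟨ih.2, by linarith⟩
  | pred k _ ih =>
    have := hu k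
    rw [ih.1, ih.2] at this
    rw [sub_add_cancel]
    exact ⟨by linarith, ih.1⟩

/-- Solutions of the three-term recurrence given by the quiddity sequence of `T`. -/
def IsQuiddityRelation (T : Set StripArc) (u : ℤ → ℤ) : Prop :=
  ∀ p, u (p + 1) + u (p - 1) = stripQuiddity T p * u p

section

variable {T : Set StripArc} {u : ℤ → ℤ}

theorem IsQuiddityRelation.apex (hT : IsStripTriangulation T) (hu : IsQuiddityRelation T u)
    {p r q : ℤ} (hpq : IsSide T p q) (hpr : IsSide T p r) (hrq : IsSide T r q)
    (h1 : u (r - 1) = u p + (innerTriangles T p r r).ncard * u r)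
    (h2 : u (r + 1) = u q + (innerTriangles T r q r).ncard * u r) :
    u r = u p + u q := by
  have h := hu r
  rw [hT.stripQuiddity_eq_of_isSide hpq hpr.lt hrq.lt,
    hT.ncard_innerTriangles hpq hpr hrq (Or.inr (Or.inl rfl)), h1, h2] at h
  push_cast at h
  linarith

/-- Crossing one triangle of the fan at `p` changes the value at the opposite end by `u p`. Both
ends are treated together because the relation at the apex `r` needs the right end of the left
polygon and the left end of the right one. -/
theorem IsQuiddityRelation.apply_add_one_and_sub_one (hT : IsStripTriangulation T)
    (hu : IsQuiddityRelation T u) {p q : ℤ} (h : IsSide T p q) :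
    u (p + 1) = u q + (innerTriangles T p q p).ncard * u p ∧
      u (q - 1) = u p + (innerTriangles T p q q).ncard * u q := by
  refine hT.isSide_induction (Q := fun p q =>
    u (p + 1) = u q + (innerTriangles T p q p).ncard * u p ∧
      u (q - 1) = u p + (innerTriangles T p q q).ncard * u q) ?_ ?_ h
  · intro p
    simp [innerTriangles_eq_empty T (p := p) (Or.inl le_rfl)]
  · rintro p r q hpq hpr hrq ⟨h1, h2⟩ ⟨h3, h4⟩
    have h5 := hu.apex hT hpq hpr hrq h2 h3
    rw [h1, h4, hT.ncard_innerTriangles hpq hpr hrq (Or.inl rfl),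
      hT.ncard_innerTriangles hpq hpr hrq (Or.inr (Or.inr rfl)),
      innerTriangles_eq_empty T (Or.inr (Or.inl hpr.lt)),
      innerTriangles_eq_empty T (Or.inr (Or.inr hrq.lt)), h5]
    simp only [Set.ncard_empty]
    push_cast
    constructor <;> ring

theorem IsQuiddityRelation.apply_mid (hT : IsStripTriangulation T)
    (hu : IsQuiddityRelation T u) {p r q : ℤ} (h : IsTriangleOf T (.inner p r q)) :
    u r = u p + u q :=
  hu.apex hT h.2.2 h.1 h.2.1 (hu.apply_add_one_and_sub_one hT h.1).2
    (hu.apply_add_one_and_sub_one hT h.2.1).1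

/-- The inner triangles at `q` account for the passage from its neighbours to `p` and `r`; the two
outer triangles leave the factor 2. -/
theorem IsQuiddityRelation.apply_outer (hT : IsStripTriangulation T)
    (hu : IsQuiddityRelation T u) {p q r : ℤ} (h : IsTriangleOf T (.outer p q))
    (h' : IsTriangleOf T (.outer q r)) : u p + u r = 2 * u q := by
  have e := hu q
  rw [hT.stripQuiddity_eq_of_bridging h h', (hu.apply_add_one_and_sub_one hT h.1).2,
    (hu.apply_add_one_and_sub_one hT h'.1).1] at e
  push_cast at e
  linarith

theorem IsQuiddityRelation.eq_zero (hT : IsStripTriangulation T)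
    (hu : IsQuiddityRelation T u) {p q : ℤ} (h : IsSide T p q) (hp : u p = 0) (hq : u q = 0)
    (x : ℤ) : u x = 0 := by
  refine eq_zero_of_recurrence hu hp ?_ x
  rw [(hu.apply_add_one_and_sub_one hT h).1, hp, hq]
  simp

theorem IsQuiddityRelation.pos (hT : IsStripTriangulation T) (hu : IsQuiddityRelation T u)
    {p q : ℤ} (h : IsSide T p q) (hp : 0 < u p) (hq : 0 < u q) {x : ℤ} (h1 : p ≤ x)
    (h2 : x ≤ q) : 0 < u x := by
  refine hT.isSide_induction (Q := fun p q => 0 < u p → 0 < u q → p ≤ x → x ≤ q → 0 < u x)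
    ?_ ?_ h hp hq h1 h2
  · intro p hp hq h1 h2
    rcases h1.eq_or_lt with rfl | h1
    · exact hp
    · obtain rfl : x = p + 1 := by omega
      exact hq
  · intro p r q h1 h2 h3 ih1 ih2 hp hq h4 h5
    have hr : 0 < u r := by
      rw [hu.apply_mid hT ⟨h2, h3, h1⟩]
      exact add_pos hp hq
    rcases le_total x r with h6 | h6
    · exact ih1 hp hr h4 h6
    · exact ih2 hr hq h6 h5

end

/-! ### Vectors attached to the vertices -/

/-- A pair of solutions of the quiddity relation, normalised on the bridging arcs of `T`: the
vector `(y p, x p)` is attached to the lower vertex `p`, the vector `(0, 1)` to the upper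
vertices. -/
structure IsVertexCoordinates (n : ℕ) (T : Set StripArc) (x y : ℤ → ℤ) (s : ℤ) : Prop where
  left : IsQuiddityRelation T x
  right : IsQuiddityRelation T y
  right_bridging : ∀ p, StripArc.bridging p ∈ T → y p = 1
  left_outer : ∀ p q, IsTriangleOf T (.outer p q) → x q = x p + 1
  right_pos : ∀ p, 0 < y p
  det_succ : ∀ p, y p * x (p + 1) - x p * y (p + 1) = 1
  right_add : ∀ p, y (p + n) = y p
  left_add : ∀ p, x (p + n) = x p + s * y p

theorem IsPeriodicStripTriangulation.exists_isVertexCoordinates {n : ℕ} (hn : 1 ≤ n)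
    {T : Set StripArc} (hT : IsPeriodicStripTriangulation n T) :
    ∃ x y s, IsVertexCoordinates n T x y s := by
  obtain ⟨c, d, -, -, h⟩ := hT.exists_outer hn 0
  obtain ⟨x, x0, x1, hx⟩ := exists_solution_recurrence (fun p => stripQuiddity T p) c 0 1
  -- The value at `c + 1` is the one that forces `y d = 1`, by the fan formula at `c`.
  obtain ⟨y, y0, y1, hy⟩ := exists_solution_recurrence (fun p => stripQuiddity T p) c 1
    (1 + (innerTriangles T c d c).ncard)
  replace hx : IsQuiddityRelation T x := hx
  replace hy : IsQuiddityRelation T y := hy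
  have xd := (hx.apply_add_one_and_sub_one hT.1 h.1).1
  have yd := (hy.apply_add_one_and_sub_one hT.1 h.1).1
  rw [x0, x1] at xd
  rw [y0, y1] at yd
  have key : ∀ p q, IsTriangleOf T (.outer p q) → x q = x p + 1 ∧ y p = 1 ∧ y q = 1 := by
    intro p q hpq
    refine hT.outer_induction hn (Q := fun p q => x q = x p + 1 ∧ y p = 1 ∧ y q = 1) h
      ⟨by linarith, by linarith, by linarith⟩ ?_ ?_ hpq
    · intro p q r h1 h2 h3
      have e1 := hx.apply_outer hT.1 h1 h2
      have e2 := hy.apply_outer hT.1 h1 h2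
      exact ⟨by linarith, by linarith, by linarith⟩
    · intro p q r h1 h2 h3
      have e1 := hx.apply_outer hT.1 h1 h2
      have e2 := hy.apply_outer hT.1 h1 h2
      exact ⟨by linarith, by linarith, by linarith⟩
  have yb : ∀ p, StripArc.bridging p ∈ T → y p = 1 := by
    intro p hp
    obtain ⟨a, b, h1, h2, h3⟩ := hT.exists_outer hn p
    have := hT.1.not_bridging_of_isSide h3.1 hp
    obtain rfl : a = p := by omega
    exact (key _ _ h3).2.1
  have h' : IsTriangleOf T (.outer (c + n) (d + n)) :=
    (hT.isTriangleOf_translate_iff (.outer c d)).2 h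
  have ya : ∀ p, y (p + n) = y p := by
    -- A solution vanishing at both ends of the side from `c` to `d` is zero; this applies to the
    -- difference of `y` and its translate.
    intro p
    have hz : IsQuiddityRelation T fun p => y (p + n) - y p := by
      intro p
      have e1 := hy p
      have e2 := hy (p + n)
      rw [hT.stripQuiddity_add] at e2
      simp only [show p + 1 + (n : ℤ) = p + n + 1 by ring,
        show p - 1 + (n : ℤ) = p + n - 1 by ring]
      linear_combination e2 - e1
    have := hz.eq_zero hT.1 h.1 (by rw [(key _ _ h).2.1, (key _ _ h').2.1]; rfl)
      (by rw [(key _ _ h).2.2, (key _ _ h').2.2]; rfl) p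
    linarith
  refine ⟨x, y, x (c + n) - x c, hx, hy, yb, fun p q hpq => (key p q hpq).1, ?_, ?_, ya, ?_⟩
  · intro p
    obtain ⟨a, b, h1, h2, h3⟩ := hT.exists_outer hn p
    exact hy.pos hT.1 h3.1 (by rw [(key _ _ h3).2.1]; exact one_pos)
      (by rw [(key _ _ h3).2.2]; exact one_pos) h1 h2.le
  · intro p
    -- The Wronskian of two solutions is constant.
    have step : ∀ k, y (k - 1) * x k - x (k - 1) * y k = y k * x (k + 1) - x k * y (k + 1) := by
      intro k
      have e1 := hx k
      have e2 := hy k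
      linear_combination x k * e2 - y k * e1
    induction p using Int.inductionOn' (b := c) with
    | zero => rw [x0, x1, y0]; simp
    | succ k _ ih =>
      have := step (k + 1)
      rw [add_sub_cancel_right] at this
      rw [← this, ih]
    | pred k _ ih =>
      rw [sub_add_cancel, step, ih]
  · intro p
    have hz : IsQuiddityRelation T fun p => x (p + n) - x p - (x (c + n) - x c) * y p := by
      intro p
      have e1 := hx p
      have e2 := hx (p + n)
      have e3 := hy p
      rw [hT.stripQuiddity_add] at e2
      simp only [show p + 1 + (n : ℤ) = p + n + 1 by ring,
        show p - 1 + (n : ℤ) = p + n - 1 by ring]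
      linear_combination e2 - e1 - (x (c + n) - x c) * e3
    have := hz.eq_zero hT.1 h.1 (by rw [y0]; ring)
      (by rw [(key _ _ h).2.2, (key _ _ h').1, (key _ _ h).1]; ring) p
    linarith

/-! ### Determinants and the frieze -/

/-- The determinant of the vectors attached to two lower vertices. -/
def vertexDet (x y : ℤ → ℤ) (p q : ℤ) : ℤ := y p * x q - x p * y q

section

variable {n : ℕ} {T : Set StripArc} {x y : ℤ → ℤ} {s : ℤ}

theorem vertexDet_swap (x y : ℤ → ℤ) (p q : ℤ) : vertexDet x y q p = -vertexDet x y p q := by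
  unfold vertexDet
  ring

theorem vertexDet_self (x y : ℤ → ℤ) (p : ℤ) : vertexDet x y p p = 0 := by
  unfold vertexDet
  ring

/-- The slopes `x p / y p` increase strictly, since `y` is positive and neighbouring vectors have
determinant 1. -/
theorem IsVertexCoordinates.vertexDet_pos (h : IsVertexCoordinates n T x y s) {p q : ℤ}
    (hpq : p < q) : 0 < vertexDet x y p q := by
  induction q, (show p + 1 ≤ q from hpq) using Int.leInduction with
  | base => simp [vertexDet, h.det_succ]
  | succ q hq ih =>
    have e : y q * vertexDet x y p (q + 1) = y (q + 1) * vertexDet x y p q + y p := by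
      have := h.det_succ q
      unfold vertexDet
      linear_combination y p * this
    have h1 := h.right_pos p
    have h2 := h.right_pos q
    have h3 := h.right_pos (q + 1)
    have h4 := ih (by omega)
    exact pos_of_mul_pos_right (e ▸ by positivity) h2.le

theorem IsVertexCoordinates.vertexDet_nonneg (h : IsVertexCoordinates n T x y s) {p q : ℤ}
    (hpq : p ≤ q) : 0 ≤ vertexDet x y p q := by
  rcases hpq.eq_or_lt with rfl | hpq
  · rw [vertexDet_self]
  · exact (h.vertexDet_pos hpq).le

theorem IsVertexCoordinates.vertexDet_unimodular (h : IsVertexCoordinates n T x y s)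
    (p q : ℤ) : vertexDet x y p q * vertexDet x y (p + 1) (q + 1) -
      vertexDet x y (p + 1) q * vertexDet x y p (q + 1) = 1 := by
  have h1 := h.det_succ p
  have h2 := h.det_succ q
  unfold vertexDet
  linear_combination h1 * (y q * x (q + 1) - x q * y (q + 1)) + h2

theorem IsVertexCoordinates.vertexDet_sub_one_add_one (h : IsVertexCoordinates n T x y s)
    (p : ℤ) : vertexDet x y (p - 1) (p + 1) = stripQuiddity T p := by
  have h1 := h.left p
  have h2 := h.right p
  have h3 := h.det_succ (p - 1)
  rw [sub_add_cancel] at h3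
  unfold vertexDet
  linear_combination y (p - 1) * h1 - x (p - 1) * h2 + stripQuiddity T p * h3

/-- Translation by `n` acts on the vectors by the shear `(y, x) ↦ (y, x + s * y)`. -/
theorem IsVertexCoordinates.vertexDet_add_mul (h : IsVertexCoordinates n T x y s)
    (p q l : ℤ) : vertexDet x y (p + l * n) (q + l * n) = vertexDet x y p q := by
  have hstep : ∀ p q, vertexDet x y (p + n) (q + n) = vertexDet x y p q := by
    intro p q
    simp only [vertexDet, h.right_add, h.left_add]
    ring
  induction l using Int.induction_on with
  | zero => simp
  | succ l ih =>
    rw [add_mul, one_mul, ← add_assoc, ← add_assoc, hstep, ih]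
  | pred l ih =>
    rw [← ih, ← hstep]
    congr 1 <;> ring

theorem IsVertexCoordinates.vertexDet_isSide (hT : IsStripTriangulation T)
    (h : IsVertexCoordinates n T x y s) {p q : ℤ} (hpq : IsSide T p q) :
    vertexDet x y p q = 1 := by
  have h1 := (h.left.apply_add_one_and_sub_one hT hpq).1
  have h2 := (h.right.apply_add_one_and_sub_one hT hpq).1
  have h3 := h.det_succ p
  unfold vertexDet
  linear_combination h3 - y p * h1 + x p * h2

theorem IsVertexCoordinates.exists_frieze (h : IsVertexCoordinates n T x y s) :
    ∃ m : ℤ → ℤ → ℕ, IsFriezeOfTriangulation T m ∧ IsPeriodicFrieze n m ∧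
      IsArithmeticFrieze n m := by
  obtain ⟨m, hm⟩ : ∃ m : ℤ → ℤ → ℕ, ∀ i j, i - 2 ≤ j →
      (m i j : ℤ) = vertexDet x y (i - 1) (j + 1) :=
    -- Truncation at 0 affects only the meaningless entries with `j < i - 2`.
    ⟨fun i j => (vertexDet x y (i - 1) (j + 1)).toNat, fun i j hij =>
      Int.toNat_of_nonneg (h.vertexDet_nonneg (by omega))⟩
  refine ⟨m, ⟨⟨?_, ?_, ?_, ?_⟩, ?_⟩, ?_, ?_⟩
  · intro i
    have := hm i (i - 2) le_rfl
    rw [show i - 2 + 1 = i - 1 by ring, vertexDet_self] at this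
    exact_mod_cast this
  · intro i
    have := hm i (i - 1) (by omega)
    have e := h.det_succ (i - 1)
    rw [sub_add_cancel] at this e
    rw [vertexDet, e] at this
    exact_mod_cast this
  · intro i j hij
    have := hm i j (by omega)
    have e := h.vertexDet_pos (p := i - 1) (q := j + 1) (by omega)
    omega
  · intro i j hij
    rw [hm i j (by omega), hm _ _ (by omega), hm _ _ (by omega), hm _ _ (by omega)]
    have := h.vertexDet_unimodular (i - 1) (j + 1)
    rw [sub_add_cancel] at this
    rwa [add_sub_cancel_right]
  · intro i
    have := hm i i (by omega)
    rw [h.vertexDet_sub_one_add_one] at this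
    exact_mod_cast this
  · intro i j hij
    have h1 := hm i j (by omega)
    have h2 := hm (i + n) (j + n) (by omega)
    have h3 := h.vertexDet_add_mul (i - 1) (j + 1) 1
    rw [one_mul] at h3
    rw [show i + n - 1 = i - 1 + (n : ℤ) by ring, show j + n + 1 = j + 1 + (n : ℤ) by ring, h3,
      ← h1] at h2
    exact_mod_cast h2.symm
  · intro i k hk _ l
    have hl : 0 ≤ (l : ℤ) * n := by positivity
    -- The increment over one period depends on `q` only through `y q`, which is periodic.
    have hstep : ∀ q, vertexDet x y (i - 1) (q + n) =
        vertexDet x y (i - 1) q + s * y (i - 1) * y q := by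
      intro q
      simp only [vertexDet, h.right_add, h.left_add]
      ring
    have hy : ∀ l : ℕ, ∀ q, y (q + l * n) = y q := by
      intro l q
      induction l with
      | zero => simp
      | succ l ih =>
        rw [show q + ((l + 1 : ℕ) : ℤ) * n = q + l * n + n by push_cast; ring, h.right_add, ih]
    rw [hm _ _ (by nlinarith), hm _ _ (by omega), hm _ _ (by omega), hm _ _ (by omega),
      show i + k - 3 + (l + 1) * (n : ℤ) + 1 = i + k - 3 + 1 + l * n + n by ring,
      show i + k - 3 + l * (n : ℤ) + 1 = i + k - 3 + 1 + l * n by ring,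
      show i + k - 3 + (n : ℤ) + 1 = i + k - 3 + 1 + n by ring, hstep, hstep, hy]
    ring

theorem IsVertexCoordinates.eq_vertexDet (h : IsVertexCoordinates n T x y s)
    {m : ℤ → ℤ → ℕ} (hm : IsFriezeOfTriangulation T m) {i j : ℤ} (hij : i - 2 ≤ j) :
    (m i j : ℤ) = vertexDet x y (i - 1) (j + 1) := by
  obtain ⟨d, hd⟩ : ∃ d : ℕ, j - i + 2 = d := ⟨(j - i + 2).toNat, by omega⟩
  induction d using Nat.strong_induction_on generalizing i j with
  | _ d ih =>
    obtain hd' | hd' | hd' | hd' : d = 0 ∨ d = 1 ∨ d = 2 ∨ 3 ≤ d := by omega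
    · obtain rfl : j = i - 2 := by omega
      rw [hm.1.row_zero, show i - 2 + 1 = i - 1 by ring, vertexDet_self]
      rfl
    · obtain rfl : j = i - 1 := by omega
      have e := h.det_succ (i - 1)
      rw [sub_add_cancel] at e ⊢
      rw [hm.1.row_one, vertexDet, e]
      rfl
    · obtain rfl : j = i := by omega
      rw [hm.2, h.vertexDet_sub_one_add_one]
    -- The unimodular rule determines `m i j` from three earlier entries, as its cofactor, the
    -- determinant of `i` and `j`, is positive.
    · have h1 := ih (d - 1) (by omega) (i := i) (j := j - 1) (by omega) (by omega)
      have h2 := ih (d - 1) (by omega) (i := i + 1) (j := j) (by omega) (by omega)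
      have h3 := ih (d - 2) (by omega) (i := i + 1) (j := j - 1) (by omega) (by omega)
      have h4 := hm.1.unimodular i (j - 1) (by omega)
      have h5 := h.vertexDet_unimodular (i - 1) j
      have h6 := h.vertexDet_pos (p := i) (q := j) (by omega)
      rw [sub_add_cancel] at h1 h3 h4 h5
      rw [add_sub_cancel_right] at h2 h3
      rw [h1, h2, h3] at h4
      have : vertexDet x y i j * ((m i j : ℤ) - vertexDet x y (i - 1) (j + 1)) = 0 := by
        linear_combination h5 - h4
      rcases mul_eq_zero.1 this with h7 | h7
      · exact absurd h7 h6.ne'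
      · linarith

end

/-! ### Labelled sets closed towards the starting vertex -/

/-- The set of lower vertices given by `A`, together with the upper vertices if `U` holds, contains
`v` and its neighbours, and with any vertex that an arc (or boundary segment) separates from `v`
it contains the ends of that arc. -/
structure IsClosedTowards (T : Set StripArc) (v : ℤ) (A : ℤ → Prop) (U : Prop) : Prop where
  self : A v
  adj : ∀ w, IsSide T v w ∨ IsSide T w v → A w
  adj_upper : StripArc.bridging v ∈ T → U
  inside : ∀ p r w, IsSide T p r → (v ≤ p ∨ r ≤ v) → p < w → w < r → A w → A p ∧ A r
  outside : ∀ p r w, IsSide T p r → p ≤ v → v ≤ r → (w < p ∨ r < w) → A w → A p ∧ A r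
  upper : ∀ p r, IsSide T p r → p ≤ v → v ≤ r → U → A p ∧ A r
  bridging : ∀ p w, StripArc.bridging p ∈ T → (v ≤ p ∧ p < w ∨ w < p ∧ p ≤ v) → A w → A p ∧ U

section

variable {T : Set StripArc} {v : ℤ} {A : ℤ → Prop} {U : Prop}

theorem IsStripTriangulation.mem_Icc_of_isSide {p r z a : ℤ} (hT : IsStripTriangulation T)
    (h : IsSide T p r) (ha : IsSide T z a ∨ IsSide T a z) (hp : p < z) (hr : z < r) :
    p ≤ a ∧ a ≤ r := by
  rcases ha with ha | ha
  · have h1 := hT.le_of_isSide h ha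
    have := ha.lt
    omega
  · have h1 := hT.le_of_isSide ha h
    have := ha.lt
    omega

theorem IsStripTriangulation.not_bridging_between {p z a : ℤ} (hT : IsStripTriangulation T)
    (h : StripArc.bridging p ∈ T) (ha : IsSide T z a ∨ IsSide T a z) :
    ¬ (z < p ∧ p < a) ∧ ¬ (a < p ∧ p < z) := by
  rcases ha with ha | ha
  · have h1 := hT.not_bridging_of_isSide ha h
    have := ha.lt
    omega
  · have h1 := hT.not_bridging_of_isSide ha h
    have := ha.lt
    omega

theorem IsStripTriangulation.isClosedTowards_adj (hT : IsStripTriangulation T) (v : ℤ) :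
    IsClosedTowards T v (fun w => w = v ∨ IsSide T v w ∨ IsSide T w v)
      (StripArc.bridging v ∈ T) := by
  have ends : ∀ p r, IsSide T p r → v = p ∨ v = r →
      (p = v ∨ IsSide T v p ∨ IsSide T p v) ∧ (r = v ∨ IsSide T v r ∨ IsSide T r v) := by
    rintro p r h (rfl | rfl)
    · exact ⟨Or.inl rfl, Or.inr (Or.inl h)⟩
    · exact ⟨Or.inr (Or.inr h), Or.inl rfl⟩
  refine ⟨Or.inl rfl, fun w hw => Or.inr hw, id, ?_, ?_, ?_, ?_⟩
  · rintro p r w hpr hv h1 h2 (rfl | hw)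
    · omega
    · have := hT.mem_Icc_of_isSide hpr hw.symm h1 h2
      exact ends p r hpr (by omega)
  · rintro p r w hpr h1 h2 h3 (rfl | hw)
    · omega
    · have := hT.mem_Icc_of_isSide hpr hw
      exact ends p r hpr (by omega)
  · intro p r hpr h1 h2 hv
    have := hT.not_bridging_of_isSide hpr hv
    exact ends p r hpr (by omega)
  · rintro p w hp hv (rfl | hw)
    · omega
    · have := hT.not_bridging_between hp hw
      obtain rfl : p = v := by omega
      exact ⟨Or.inl rfl, hp⟩

/-- If a side separates `z` from `v`, it also separates `a` or `b` from `v`, and the old closedness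
applies, or else `a` and `b`, being distinct, are its two ends. A bridging arc has a single lower
end, so one of `a`, `b` lies strictly beyond it. -/
theorem IsClosedTowards.insert_of_adj (hT : IsStripTriangulation T)
    (h : IsClosedTowards T v A U) {a b z : ℤ} (hab : a ≠ b)
    (ha : IsSide T z a ∨ IsSide T a z) (hb : IsSide T z b ∨ IsSide T b z) (haA : A a)
    (hbA : A b) : IsClosedTowards T v (fun w => A w ∨ w = z) U := by
  refine ⟨Or.inl h.self, fun w hw => Or.inl (h.adj w hw), h.adj_upper, ?_, ?_, ?_, ?_⟩
  · rintro p r w hpr hv h1 h2 (hw | rfl)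
    · exact (h.inside p r w hpr hv h1 h2 hw).imp Or.inl Or.inl
    · have e1 := hT.mem_Icc_of_isSide hpr ha h1 h2
      have e2 := hT.mem_Icc_of_isSide hpr hb h1 h2
      by_cases ha' : p < a ∧ a < r
      · exact (h.inside p r a hpr hv ha'.1 ha'.2 haA).imp Or.inl Or.inl
      by_cases hb' : p < b ∧ b < r
      · exact (h.inside p r b hpr hv hb'.1 hb'.2 hbA).imp Or.inl Or.inl
      have : a = p ∧ b = r ∨ a = r ∧ b = p := by omega
      rcases this with ⟨rfl, rfl⟩ | ⟨rfl, rfl⟩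
      · exact ⟨Or.inl haA, Or.inl hbA⟩
      · exact ⟨Or.inl hbA, Or.inl haA⟩
  · rintro p r w hpr h1 h2 h3 (hw | rfl)
    · exact (h.outside p r w hpr h1 h2 h3 hw).imp Or.inl Or.inl
    · have e1 := hT.mem_Icc_of_isSide hpr ha.symm
      have e2 := hT.mem_Icc_of_isSide hpr hb.symm
      by_cases ha' : a < p ∨ r < a
      · exact (h.outside p r a hpr h1 h2 ha' haA).imp Or.inl Or.inl
      by_cases hb' : b < p ∨ r < b
      · exact (h.outside p r b hpr h1 h2 hb' hbA).imp Or.inl Or.inl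
      have : a = p ∧ b = r ∨ a = r ∧ b = p := by omega
      rcases this with ⟨rfl, rfl⟩ | ⟨rfl, rfl⟩
      · exact ⟨Or.inl haA, Or.inl hbA⟩
      · exact ⟨Or.inl hbA, Or.inl haA⟩
  · intro p r hpr h1 h2 hU
    exact (h.upper p r hpr h1 h2 hU).imp Or.inl Or.inl
  · rintro p w hp hv (hw | rfl)
    · exact (h.bridging p w hp hv hw).imp_left Or.inl
    · have e1 := hT.not_bridging_between hp ha
      have e2 := hT.not_bridging_between hp hb
      by_cases ha' : a = p
      · exact (h.bridging p b hp (by omega) hbA).imp_left Or.inl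
      · exact (h.bridging p a hp (by omega) haA).imp_left Or.inl

theorem IsClosedTowards.insert_of_outer (hT : IsStripTriangulation T)
    (h : IsClosedTowards T v A U) {a z : ℤ} (ha : IsSide T z a ∨ IsSide T a z)
    (hz : StripArc.bridging z ∈ T) (haA : A a) (hU : U) :
    IsClosedTowards T v (fun w => A w ∨ w = z) U := by
  refine ⟨Or.inl h.self, fun w hw => Or.inl (h.adj w hw), h.adj_upper, ?_, ?_, ?_, ?_⟩
  · rintro p r w hpr hv h1 h2 (hw | rfl)
    · exact (h.inside p r w hpr hv h1 h2 hw).imp Or.inl Or.inl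
    · exact absurd ⟨h1, h2⟩ (hT.not_bridging_of_isSide hpr hz)
  · rintro p r w hpr h1 h2 - -
    exact (h.upper p r hpr h1 h2 hU).imp Or.inl Or.inl
  · intro p r hpr h1 h2 hU
    exact (h.upper p r hpr h1 h2 hU).imp Or.inl Or.inl
  · rintro p w hp hv (hw | rfl)
    · exact (h.bridging p w hp hv hw).imp_left Or.inl
    · have e1 := hT.not_bridging_between hp ha
      by_cases ha' : a = p
      · exact ⟨Or.inl (ha' ▸ haA), hU⟩
      · exact (h.bridging p a hp (by omega) haA).imp_left Or.inl

theorem IsClosedTowards.insert_upper (hT : IsStripTriangulation T)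
    (h : IsClosedTowards T v A U) {a b : ℤ} (hab : IsTriangleOf T (.outer a b))
    (ha : A a) (hb : A b) : IsClosedTowards T v A True := by
  refine ⟨h.self, h.adj, fun _ => trivial, h.inside, h.outside, ?_,
    fun p w hp hv hw => ⟨(h.bridging p w hp hv hw).1, trivial⟩⟩
  intro p r hpr h1 h2 _
  have e1 := hT.not_bridging_of_isSide hpr hab.2.1
  have e2 := hT.not_bridging_of_isSide hpr hab.2.2
  have e3 := hab.1.lt
  by_cases ha' : a < p ∨ r < a
  · exact h.outside p r a hpr h1 h2 ha' ha
  by_cases hb' : b < p ∨ r < b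
  · exact h.outside p r b hpr h1 h2 hb' hb
  obtain ⟨rfl, rfl⟩ : a = p ∧ b = r := by omega
  exact ⟨ha, hb⟩

/-- If `v` lay elsewhere, a side of the triangle ending at `p` would separate it from a labelled
corner, and closedness would label `p`. The next five lemmas locate `v` in the same way for the
other positions of the unlabelled corner. -/
theorem IsClosedTowards.between_of_not_left (h : IsClosedTowards T v A U) {p q r : ℤ}
    (hτ : IsTriangleOf T (.inner p q r)) (hp : ¬ A p) (hq : A q) (hr : A r) :
    q ≤ v ∧ v ≤ r := by
  obtain ⟨h1, h2, h3⟩ := hτ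
  have := h1.lt
  have := h2.lt
  by_contra hv
  by_cases hv' : v ≤ p ∨ r ≤ v
  · exact hp (h.inside p r q h3 hv' (by omega) (by omega) hq).1
  · exact hp (h.outside p q r h1 (by omega) (by omega) (by omega) hr).1

theorem IsClosedTowards.between_of_not_right (h : IsClosedTowards T v A U) {p q r : ℤ}
    (hτ : IsTriangleOf T (.inner p q r)) (hp : A p) (hq : A q) (hr : ¬ A r) :
    p ≤ v ∧ v ≤ q := by
  obtain ⟨h1, h2, h3⟩ := hτ
  have := h1.lt
  have := h2.lt
  by_contra hv
  by_cases hv' : v ≤ p ∨ r ≤ v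
  · exact hr (h.inside p r q h3 hv' (by omega) (by omega) hq).2
  · exact hr (h.outside q r p h2 (by omega) (by omega) (by omega) hp).2

theorem IsClosedTowards.not_between_of_not_mid (h : IsClosedTowards T v A U) {p q r : ℤ}
    (hτ : IsTriangleOf T (.inner p q r)) (hp : A p) (hq : ¬ A q) (hr : A r) :
    v ≤ p ∨ r ≤ v := by
  obtain ⟨h1, h2, h3⟩ := hτ
  have := h1.lt
  have := h2.lt
  by_contra hv
  by_cases hv' : v ≤ q
  · exact hq (h.outside p q r h1 (by omega) (by omega) (by omega) hr).2
  · exact hq (h.outside q r p h2 (by omega) (by omega) (by omega) hp).1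

theorem IsClosedTowards.le_of_not_outer_right (h : IsClosedTowards T v A U) {p q : ℤ}
    (hτ : IsTriangleOf T (.outer p q)) (hp : A p) (hq : ¬ A q) (hU : U) : v ≤ p := by
  obtain ⟨h1, h2, h3⟩ := hτ
  have := h1.lt
  by_contra hv
  by_cases hv' : v ≤ q
  · exact hq (h.upper p q h1 (by omega) hv' hU).2
  · exact hq (h.bridging q p h3 (by omega) hp).1

theorem IsClosedTowards.le_of_not_outer_left (h : IsClosedTowards T v A U) {p q : ℤ}
    (hτ : IsTriangleOf T (.outer p q)) (hp : ¬ A p) (hq : A q) (hU : U) : q ≤ v := by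
  obtain ⟨h1, h2, h3⟩ := hτ
  have := h1.lt
  by_contra hv
  by_cases hv' : p ≤ v
  · exact hp (h.upper p q h1 hv' (by omega) hU).1
  · exact hp (h.bridging p q h2 (by omega) hq).1

theorem IsClosedTowards.between_of_not_upper (h : IsClosedTowards T v A U) {p q : ℤ}
    (hτ : IsTriangleOf T (.outer p q)) (hp : A p) (hq : A q) (hU : ¬ U) :
    p ≤ v ∧ v ≤ q := by
  obtain ⟨h1, h2, h3⟩ := hτ
  have := h1.lt
  by_contra hv
  by_cases hv' : v ≤ p
  · exact hU (h.bridging p q h2 (by omega) hq).2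
  · exact hU (h.bridging q p h3 (by omega) hp).2

end

/-! ### Labels are absolute values of determinants -/

/-- All labels of `f` are the determinants of the attached vectors, up to sign, and the set of
labelled vertices is closed towards the starting vertex. -/
structure IsCorrectLabelling (T : Set StripArc) (x y : ℤ → ℤ) (v : ℤ)
    (f : StripVertex → Option ℕ) : Prop where
  lower_eq : ∀ w a, f (.lower w) = some a → (a : ℤ) = |vertexDet x y v w|
  upper_eq : ∀ k a, f (.upper k) = some a → (a : ℤ) = y v
  upper_iff : ∀ k k', (f (.upper k)).isSome ↔ (f (.upper k')).isSome
  closed : IsClosedTowards T v (fun w => (f (.lower w)).isSome) ((f (.upper 0)).isSome)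

theorem isSome_initialLabels_lower (n : ℕ) (T : Set StripArc) (v w : ℤ) :
    (initialLabels n T v (.lower w)).isSome ↔ w = v ∨ IsSide T v w ∨ IsSide T w v := by
  have e : (∃ w', (StripVertex.lower w).Same w' ∧ IsJoined n T v w') ↔
      IsSide T v w ∨ IsSide T w v := by
    constructor
    · rintro ⟨k | w', h1, h2⟩
      · exact h1.elim
      · obtain rfl : w = w' := h1
        exact h2
    · exact fun h => ⟨.lower w, rfl, h⟩
  unfold initialLabels
  rw [e, StripVertex.lower.injEq]
  split_ifs with h1 h2 <;> simp [*]

theorem initialLabels_upper (n : ℕ) (T : Set StripArc) (v k : ℤ) [Decidable (.bridging v ∈ T)] :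
    initialLabels n T v (.upper k) = if .bridging v ∈ T then some 1 else none := by
  have e : (∃ w', (StripVertex.upper k).Same w' ∧ IsJoined n T v w') ↔
      .bridging v ∈ T := by
    constructor
    · rintro ⟨k' | w', h1, h2⟩
      · exact h2.1
      · exact h1.elim
    · exact fun h => ⟨.upper (superscript n v), trivial, h, rfl⟩
  unfold initialLabels
  simp [e]

section

variable {n : ℕ} {T : Set StripArc} {x y : ℤ → ℤ} {s v : ℤ} {f : StripVertex → Option ℕ}

theorem IsVertexCoordinates.abs_vertexDet_of_le (h : IsVertexCoordinates n T x y s) {p q : ℤ}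
    (hpq : p ≤ q) : |vertexDet x y p q| = vertexDet x y p q :=
  abs_of_nonneg (h.vertexDet_nonneg hpq)

theorem IsVertexCoordinates.abs_vertexDet_of_ge (h : IsVertexCoordinates n T x y s) {p q : ℤ}
    (hpq : q ≤ p) : |vertexDet x y p q| = -vertexDet x y p q := by
  rw [vertexDet_swap, abs_neg, h.abs_vertexDet_of_le hpq, neg_neg]

theorem IsVertexCoordinates.vertexDet_inner (hT : IsStripTriangulation T)
    (h : IsVertexCoordinates n T x y s) {p q r : ℤ} (hτ : IsTriangleOf T (.inner p q r))
    (v : ℤ) : vertexDet x y v q = vertexDet x y v p + vertexDet x y v r := by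
  rw [vertexDet, vertexDet, vertexDet, h.left.apply_mid hT hτ, h.right.apply_mid hT hτ]
  ring

theorem IsVertexCoordinates.vertexDet_outer (h : IsVertexCoordinates n T x y s) {p q : ℤ}
    (hτ : IsTriangleOf T (.outer p q)) (v : ℤ) :
    vertexDet x y v q = vertexDet x y v p + y v := by
  rw [vertexDet, vertexDet, h.left_outer p q hτ, h.right_bridging p hτ.2.1,
    h.right_bridging q hτ.2.2]
  ring

theorem IsVertexCoordinates.isCorrectLabelling_initialLabels (hT : IsStripTriangulation T)
    (h : IsVertexCoordinates n T x y s) (v : ℤ) :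
    IsCorrectLabelling T x y v (initialLabels n T v) := by
  classical
  refine ⟨fun w a hw => ?_, fun k a hk => ?_, fun k k' => ?_, ?_⟩
  · by_cases hwv : w = v
    · subst hwv
      rw [vertexDet_self]
      simp only [initialLabels, if_true, Option.some.injEq] at hw
      subst hw
      simp
    · have h1 := (isSome_initialLabels_lower n T v w).1 (hw ▸ rfl)
      have ha : a = 1 := by
        simp only [initialLabels, StripVertex.lower.injEq, hwv, if_false] at hw
        split_ifs at hw
        simpa using hw.symm
      rcases h1 with h1 | h1 | h1
      · exact absurd h1 hwv
      · rw [h.vertexDet_isSide hT h1, ha]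
        rfl
      · rw [vertexDet_swap, h.vertexDet_isSide hT h1, ha]
        rfl
  · rw [initialLabels_upper] at hk
    split_ifs at hk with hv
    obtain rfl : 1 = a := by simpa using hk
    rw [h.right_bridging v hv]
    rfl
  · rw [initialLabels_upper, initialLabels_upper]
  · have := hT.isClosedTowards_adj v
    simp only [isSome_initialLabels_lower, initialLabels_upper]
    convert this
    by_cases hv : StripArc.bridging v ∈ T <;> simp [hv]

theorem attachLabel_lower_lower (f : StripVertex → Option ℕ) (z : ℤ) (c : ℕ) (w : ℤ) :
    attachLabel f (.lower z) c (.lower w) = if w = z then some c else f (.lower w) := by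
  by_cases hwz : w = z <;> simp [attachLabel, StripVertex.Same, hwz]

theorem IsCorrectLabelling.attachLabel_lower (hf : IsCorrectLabelling T x y v f) {z : ℤ} {c : ℕ}
    (hz : IsClosedTowards T v (fun w => (f (.lower w)).isSome ∨ w = z) ((f (.upper 0)).isSome))
    (hc : (c : ℤ) = |vertexDet x y v z|) :
    IsCorrectLabelling T x y v (attachLabel f (.lower z) c) := by
  have hu : ∀ k, attachLabel f (.lower z) c (.upper k) = f (.upper k) := fun k => by
    simp [attachLabel, StripVertex.Same]
  refine ⟨fun w a hw => ?_, fun k a hk => hf.upper_eq k a (hu k ▸ hk), fun k k' => ?_, ?_⟩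
  · rw [attachLabel_lower_lower] at hw
    by_cases hwz : w = z
    · rw [if_pos hwz] at hw
      rw [hwz, ← hc, Option.some.inj hw]
    · rw [if_neg hwz] at hw
      exact hf.lower_eq w a hw
  · rw [hu, hu]
    exact hf.upper_iff k k'
  · rw [hu]
    convert hz using 2 with w
    rw [attachLabel_lower_lower]
    split_ifs with hwz <;> simp [hwz]

theorem IsCorrectLabelling.attachLabel_upper (hf : IsCorrectLabelling T x y v f) {k : ℤ} {c : ℕ}
    (hk : IsClosedTowards T v (fun w => (f (.lower w)).isSome) True) (hc : (c : ℤ) = y v) :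
    IsCorrectLabelling T x y v (attachLabel f (.upper k) c) := by
  have hl : ∀ w, attachLabel f (.upper k) c (.lower w) = f (.lower w) := fun w => by
    simp [attachLabel, StripVertex.Same]
  have hu : ∀ k', attachLabel f (.upper k) c (.upper k') = some c := fun k => by
    simp [attachLabel, StripVertex.Same]
  refine ⟨fun w a hw => hf.lower_eq w a (hl w ▸ hw), fun k a hk => ?_, fun k k' => ?_, ?_⟩
  · rw [hu] at hk
    rw [← hc, Option.some.inj hk]
  · rw [hu, hu]
  · simp only [hl, hu]
    simpa using hk

/-- The position of `v` fixes the signs of the three determinants, and with these signs the linear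
relation between the corner vectors says that the new absolute value is the sum of the old ones. The
other steps differ only in the signs. -/
theorem IsCorrectLabelling.step_left (hT : IsStripTriangulation T)
    (h : IsVertexCoordinates n T x y s) (hf : IsCorrectLabelling T x y v f) {p q r : ℤ}
    (hτ : IsTriangleOf T (.inner p q r)) {a b : ℕ} (ha : f (.lower q) = some a)
    (hb : f (.lower r) = some b) (hc : f (.lower p) = none) :
    IsCorrectLabelling T x y v (attachLabel f (.lower p) (a + b)) := by
  have hv := hf.closed.between_of_not_left hτ (by simp [hc]) (by simp [ha]) (by simp [hb])
  have l1 := hτ.1.lt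
  refine hf.attachLabel_lower (hf.closed.insert_of_adj hT hτ.2.1.lt.ne (Or.inl hτ.1)
    (Or.inl hτ.2.2) (by simp [ha]) (by simp [hb])) ?_
  push_cast
  rw [hf.lower_eq q a ha, hf.lower_eq r b hb, h.abs_vertexDet_of_ge hv.1,
    h.abs_vertexDet_of_le hv.2, h.abs_vertexDet_of_ge (by omega), h.vertexDet_inner hT hτ]
  ring

theorem IsCorrectLabelling.step_mid (hT : IsStripTriangulation T)
    (h : IsVertexCoordinates n T x y s) (hf : IsCorrectLabelling T x y v f) {p q r : ℤ}
    (hτ : IsTriangleOf T (.inner p q r)) {a b : ℕ} (ha : f (.lower p) = some a)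
    (hb : f (.lower r) = some b) (hc : f (.lower q) = none) :
    IsCorrectLabelling T x y v (attachLabel f (.lower q) (a + b)) := by
  have hv := hf.closed.not_between_of_not_mid hτ (by simp [ha]) (by simp [hc]) (by simp [hb])
  have l1 := hτ.1.lt
  have l2 := hτ.2.1.lt
  refine hf.attachLabel_lower (hf.closed.insert_of_adj hT hτ.2.2.lt.ne (Or.inr hτ.1)
    (Or.inl hτ.2.1) (by simp [ha]) (by simp [hb])) ?_
  push_cast
  rw [hf.lower_eq p a ha, hf.lower_eq r b hb]
  rcases hv with hv | hv
  · rw [h.abs_vertexDet_of_le hv, h.abs_vertexDet_of_le (by omega),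
      h.abs_vertexDet_of_le (by omega), h.vertexDet_inner hT hτ]
  · rw [h.abs_vertexDet_of_ge hv, h.abs_vertexDet_of_ge (by omega),
      h.abs_vertexDet_of_ge (by omega), h.vertexDet_inner hT hτ]
    ring

theorem IsCorrectLabelling.step_right (hT : IsStripTriangulation T)
    (h : IsVertexCoordinates n T x y s) (hf : IsCorrectLabelling T x y v f) {p q r : ℤ}
    (hτ : IsTriangleOf T (.inner p q r)) {a b : ℕ} (ha : f (.lower p) = some a)
    (hb : f (.lower q) = some b) (hc : f (.lower r) = none) :
    IsCorrectLabelling T x y v (attachLabel f (.lower r) (a + b)) := by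
  have hv := hf.closed.between_of_not_right hτ (by simp [ha]) (by simp [hb]) (by simp [hc])
  have l2 := hτ.2.1.lt
  refine hf.attachLabel_lower (hf.closed.insert_of_adj hT hτ.1.lt.ne (Or.inr hτ.2.2)
    (Or.inr hτ.2.1) (by simp [ha]) (by simp [hb])) ?_
  push_cast
  rw [hf.lower_eq p a ha, hf.lower_eq q b hb, h.abs_vertexDet_of_ge hv.1,
    h.abs_vertexDet_of_le hv.2, h.abs_vertexDet_of_le (by omega), h.vertexDet_inner hT hτ]
  ring

theorem IsCorrectLabelling.step_outer_left (hT : IsStripTriangulation T)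
    (h : IsVertexCoordinates n T x y s) (hf : IsCorrectLabelling T x y v f) {p q k : ℤ}
    (hτ : IsTriangleOf T (.outer p q)) {a b : ℕ} (ha : f (.lower q) = some a)
    (hb : f (.upper k) = some b) (hc : f (.lower p) = none) :
    IsCorrectLabelling T x y v (attachLabel f (.lower p) (a + b)) := by
  have hU : (f (.upper 0)).isSome := (hf.upper_iff k 0).1 (by simp [hb])
  have hv := hf.closed.le_of_not_outer_left hτ (by simp [hc]) (by simp [ha]) hU
  have l1 := hτ.1.lt
  refine hf.attachLabel_lower (hf.closed.insert_of_outer hT (Or.inl hτ.1) hτ.2.1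
    (by simp [ha]) hU) ?_
  push_cast
  rw [hf.lower_eq q a ha, hf.upper_eq k b hb, h.abs_vertexDet_of_ge hv,
    h.abs_vertexDet_of_ge (by omega), h.vertexDet_outer hτ]
  ring

theorem IsCorrectLabelling.step_outer_right (hT : IsStripTriangulation T)
    (h : IsVertexCoordinates n T x y s) (hf : IsCorrectLabelling T x y v f) {p q k : ℤ}
    (hτ : IsTriangleOf T (.outer p q)) {a b : ℕ} (ha : f (.lower p) = some a)
    (hb : f (.upper k) = some b) (hc : f (.lower q) = none) :
    IsCorrectLabelling T x y v (attachLabel f (.lower q) (a + b)) := by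
  have hU : (f (.upper 0)).isSome := (hf.upper_iff k 0).1 (by simp [hb])
  have hv := hf.closed.le_of_not_outer_right hτ (by simp [ha]) (by simp [hc]) hU
  have l1 := hτ.1.lt
  refine hf.attachLabel_lower (hf.closed.insert_of_outer hT (Or.inr hτ.1) hτ.2.2
    (by simp [ha]) hU) ?_
  push_cast
  rw [hf.lower_eq p a ha, hf.upper_eq k b hb, h.abs_vertexDet_of_le hv,
    h.abs_vertexDet_of_le (by omega), h.vertexDet_outer hτ]

theorem IsCorrectLabelling.step_outer_upper (hT : IsStripTriangulation T)
    (h : IsVertexCoordinates n T x y s) (hf : IsCorrectLabelling T x y v f) {p q k : ℤ}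
    (hτ : IsTriangleOf T (.outer p q)) {a b : ℕ} (ha : f (.lower p) = some a)
    (hb : f (.lower q) = some b) (hc : f (.upper k) = none) :
    IsCorrectLabelling T x y v (attachLabel f (.upper k) (a + b)) := by
  have hU : ¬ (f (.upper 0)).isSome := fun hU => by
    simpa [hc] using (hf.upper_iff 0 k).1 hU
  have hv := hf.closed.between_of_not_upper hτ (by simp [ha]) (by simp [hb]) hU
  refine hf.attachLabel_upper (hf.closed.insert_upper hT hτ (by simp [ha]) (by simp [hb])) ?_
  push_cast
  rw [hf.lower_eq p a ha, hf.lower_eq q b hb, h.abs_vertexDet_of_ge hv.1,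
    h.abs_vertexDet_of_le hv.2, h.vertexDet_outer hτ]
  ring

theorem perm_fin_three_cases : ∀ σ : Equiv.Perm (Fin 3),
    (σ 0 = 0 ∧ σ 1 = 1 ∧ σ 2 = 2) ∨ (σ 0 = 1 ∧ σ 1 = 0 ∧ σ 2 = 2) ∨
    (σ 0 = 0 ∧ σ 1 = 2 ∧ σ 2 = 1) ∨ (σ 0 = 2 ∧ σ 1 = 0 ∧ σ 2 = 1) ∨
    (σ 0 = 1 ∧ σ 1 = 2 ∧ σ 2 = 0) ∨ (σ 0 = 2 ∧ σ 1 = 1 ∧ σ 2 = 0) := by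
  decide

theorem IsPartialLabelling.isCorrectLabelling (hT : IsStripTriangulation T)
    (h : IsVertexCoordinates n T x y s) (hf : IsPartialLabelling n T v f) :
    IsCorrectLabelling T x y v f := by
  induction hf with
  | start => exact h.isCorrectLabelling_initialLabels hT v
  | step f _ τ hτ σ a b ha hb hc ih =>
    rcases τ with ⟨p, q, r⟩ | ⟨p, q⟩
    · rcases perm_fin_three_cases σ with ⟨e0, e1, e2⟩ | ⟨e0, e1, e2⟩ | ⟨e0, e1, e2⟩ |
        ⟨e0, e1, e2⟩ | ⟨e0, e1, e2⟩ | ⟨e0, e1, e2⟩ <;> rw [e0] at ha <;> rw [e1] at hb <;>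
        rw [e2] at hc ⊢
      · exact ih.step_right hT h hτ ha hb hc
      · exact add_comm a b ▸ ih.step_right hT h hτ hb ha hc
      · exact ih.step_mid hT h hτ ha hb hc
      · exact add_comm a b ▸ ih.step_mid hT h hτ hb ha hc
      · exact ih.step_left hT h hτ ha hb hc
      · exact add_comm a b ▸ ih.step_left hT h hτ hb ha hc
    · rcases perm_fin_three_cases σ with ⟨e0, e1, e2⟩ | ⟨e0, e1, e2⟩ | ⟨e0, e1, e2⟩ |
        ⟨e0, e1, e2⟩ | ⟨e0, e1, e2⟩ | ⟨e0, e1, e2⟩ <;> rw [e0] at ha <;> rw [e1] at hb <;>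
        rw [e2] at hc ⊢
      · exact ih.step_outer_upper hT h hτ ha hb hc
      · exact add_comm a b ▸ ih.step_outer_upper hT h hτ hb ha hc
      · exact ih.step_outer_right hT h hτ ha hb hc
      · exact add_comm a b ▸ ih.step_outer_right hT h hτ hb ha hc
      · exact ih.step_outer_left hT h hτ ha hb hc
      · exact add_comm a b ▸ ih.step_outer_left hT h hτ hb ha hc

/-! ### Every lower vertex receives a label -/

theorem exists_perm_fin_three : ∀ i j k : Fin 3, i ≠ j → i ≠ k → j ≠ k →
    ∃ σ : Equiv.Perm (Fin 3), σ 0 = i ∧ σ 1 = j ∧ σ 2 = k := by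
  decide

theorem IsPartialLabelling.exists_extension (hf : IsPartialLabelling n T v f)
    {τ : StripTriangle} (hτ : IsTriangleOf T τ) (i j k : Fin 3) (hij : i ≠ j) (hik : i ≠ k)
    (hjk : j ≠ k) (hi : (f (τ.corner n i)).isSome) (hj : (f (τ.corner n j)).isSome) :
    ∃ g, IsPartialLabelling n T v g ∧ (∀ w, (f w).isSome → (g w).isSome) ∧
      (g (τ.corner n k)).isSome := by
  by_cases hk : (f (τ.corner n k)).isSome
  · exact ⟨f, hf, fun w => id, hk⟩
  · obtain ⟨σ, rfl, rfl, rfl⟩ := exists_perm_fin_three i j k hij hik hjk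
    obtain ⟨a, ha⟩ := Option.isSome_iff_exists.1 hi
    obtain ⟨b, hb⟩ := Option.isSome_iff_exists.1 hj
    refine ⟨_, hf.step f τ hτ σ a b ha hb (by simpa using hk), fun w hw => ?_, ?_⟩
    · unfold attachLabel
      split_ifs
      · rfl
      · exact hw
    · have : (τ.corner n (σ 2)).Same (τ.corner n (σ 2)) := by
        cases τ.corner n (σ 2) <;> simp [StripVertex.Same]
      simp [attachLabel, this]

/-- Once both ends of a side are labelled, every lower vertex below it can be labelled. -/
theorem IsPartialLabelling.exists_extension_below (hT : IsStripTriangulation T)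
    (hf : IsPartialLabelling n T v f) {p q w : ℤ} (h : IsSide T p q)
    (hp : (f (.lower p)).isSome) (hq : (f (.lower q)).isSome) (hpw : p ≤ w) (hwq : w ≤ q) :
    ∃ g, IsPartialLabelling n T v g ∧ (g (.lower w)).isSome := by
  refine hT.isSide_induction (Q := fun p q => ∀ f, IsPartialLabelling n T v f →
    (f (.lower p)).isSome → (f (.lower q)).isSome → p ≤ w → w ≤ q →
    ∃ g, IsPartialLabelling n T v g ∧ (g (.lower w)).isSome) ?_ ?_ h f hf hp hq hpw hwq
  · intro p f hf hp hq h1 h2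
    rcases h1.eq_or_lt with rfl | h1
    · exact ⟨f, hf, hp⟩
    · obtain rfl : w = p + 1 := by omega
      exact ⟨f, hf, hq⟩
  · intro p r q hpq hpr hrq ih1 ih2 f hf hp hq h1 h2
    obtain ⟨g, hg, hfg, hr⟩ := hf.exists_extension (τ := .inner p r q) ⟨hpr, hrq, hpq⟩ 0 2 1
      (by decide) (by decide) (by decide) hp hq
    rcases le_total w r with h3 | h3
    · exact ih1 g hg (hfg _ hp) hr h1 h3
    · exact ih2 g hg hr (hfg _ hq) h3 h2

/-- Both ends of a side above the starting vertex can be labelled. -/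
theorem IsStripTriangulation.exists_isPartialLabelling_above (hT : IsStripTriangulation T)
    (n : ℕ) {p q : ℤ} (h : IsSide T p q) (hpv : p ≤ v) (hvq : v ≤ q) :
    ∃ f, IsPartialLabelling n T v f ∧ (f (.lower p)).isSome ∧ (f (.lower q)).isSome := by
  refine hT.isSide_induction (Q := fun p q => p ≤ v → v ≤ q →
    ∃ f, IsPartialLabelling n T v f ∧ (f (.lower p)).isSome ∧ (f (.lower q)).isSome)
    ?_ ?_ h hpv hvq
  · intro p h1 h2
    refine ⟨_, .start, ?_⟩
    rw [isSome_initialLabels_lower, isSome_initialLabels_lower]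
    rcases h1.eq_or_lt with rfl | h1
    · exact ⟨Or.inl rfl, Or.inr (Or.inl (isSide_succ T p))⟩
    · obtain rfl : v = p + 1 := by omega
      exact ⟨Or.inr (Or.inr (isSide_succ T p)), Or.inl rfl⟩
  · intro p r q hpq hpr hrq ih1 ih2 h1 h2
    rcases le_total v r with h3 | h3
    · obtain ⟨f, hf, hp, hr⟩ := ih1 h1 h3
      obtain ⟨g, hg, hfg, hq⟩ := hf.exists_extension (τ := .inner p r q) ⟨hpr, hrq, hpq⟩ 0 1 2
        (by decide) (by decide) (by decide) hp hr
      exact ⟨g, hg, hfg _ hp, hq⟩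
    · obtain ⟨f, hf, hr, hq⟩ := ih2 h3 h2
      obtain ⟨g, hg, hfg, hp⟩ := hf.exists_extension (τ := .inner p r q) ⟨hpr, hrq, hpq⟩ 1 2 0
        (by decide) (by decide) (by decide) hr hq
      exact ⟨g, hg, hp, hfg _ hq⟩

/-- The labelling climbs from `v` to the outer triangle over it, labels the upper vertices there,
moves along the chain of outer triangles to the one over `w`, and descends. -/
theorem IsPeriodicStripTriangulation.exists_isPartialLabelling (hn : 1 ≤ n)
    (hT : IsPeriodicStripTriangulation n T) (v w : ℤ) :
    ∃ f, IsPartialLabelling n T v f ∧ (f (.lower w)).isSome := by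
  obtain ⟨x, y, s, h⟩ := hT.exists_isVertexCoordinates hn
  obtain ⟨p₀, q₀, h1, h2, h3⟩ := hT.exists_outer hn v
  obtain ⟨p, q, h4, h5, h6⟩ := hT.exists_outer hn w
  have key : ∃ f, IsPartialLabelling n T v f ∧ (f (.lower p)).isSome ∧ (f (.lower q)).isSome ∧
      ∀ k, (f (.upper k)).isSome := by
    refine hT.outer_induction hn (Q := fun p q => ∃ f, IsPartialLabelling n T v f ∧
      (f (.lower p)).isSome ∧ (f (.lower q)).isSome ∧ ∀ k, (f (.upper k)).isSome) h3
      ?_ ?_ ?_ h6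
    · obtain ⟨f, hf, hp, hq⟩ := hT.1.exists_isPartialLabelling_above n h3.1 h1 h2.le
      obtain ⟨g, hg, hfg, hU⟩ := hf.exists_extension h3 0 1 2
        (by decide) (by decide) (by decide) hp hq
      -- Only the listed upper corner is labelled by construction; the others share its status in
      -- any partial labelling.
      exact ⟨g, hg, hfg _ hp, hfg _ hq, fun k =>
        ((hg.isCorrectLabelling hT.1 h).upper_iff _ k).1 hU⟩
    · rintro p q r - hqr ⟨f, hf, hp, hq, hU⟩
      obtain ⟨g, hg, hfg, hr⟩ := hf.exists_extension hqr 0 2 1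
        (by decide) (by decide) (by decide) hq (hU _)
      exact ⟨g, hg, hfg _ hq, hr, fun k => hfg _ (hU k)⟩
    · rintro p q r hpq - ⟨f, hf, hq, hr, hU⟩
      obtain ⟨g, hg, hfg, hp⟩ := hf.exists_extension hpq 1 2 0
        (by decide) (by decide) (by decide) hq (hU _)
      exact ⟨g, hg, hp, hfg _ hq, fun k => hfg _ (hU k)⟩
  obtain ⟨f, hf, hp, hq, -⟩ := key
  exact hf.exists_extension_below hT.1 h6.1 hp hq h4 h5.le

theorem IsVertexCoordinates.hasLabel_iff (hn : 1 ≤ n) (hT : IsPeriodicStripTriangulation n T)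
    (h : IsVertexCoordinates n T x y s) (v w : ℤ) (a : ℕ) :
    HasLabel n T v (.lower w) a ↔ (a : ℤ) = |vertexDet x y v w| := by
  constructor
  · rintro ⟨f, hf, hw⟩
    exact (hf.isCorrectLabelling hT.1 h).lower_eq w a hw
  · intro ha
    obtain ⟨f, hf, hw⟩ := hT.exists_isPartialLabelling hn v w
    obtain ⟨b, hb⟩ := Option.isSome_iff_exists.1 hw
    have := (hf.isCorrectLabelling hT.1 h).lower_eq w b hb
    obtain rfl : a = b := by exact_mod_cast ha.trans this.symm
    exact ⟨f, hf, hb⟩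

end

theorem mainTheorem4 (n : ℕ) (hn : 1 ≤ n) (T : Set StripArc)
    (hT : IsPeriodicStripTriangulation n T) :
    (∃ m : ℤ → ℤ → ℕ, IsFriezeOfTriangulation T m ∧ IsPeriodicFrieze n m ∧
      IsArithmeticFrieze n m) ∧
    ∀ m : ℤ → ℤ → ℕ, IsFriezeOfTriangulation T m →
      ∀ i j k : ℤ, -2 ≤ j - i → ∀ a : ℕ,
        HasLabel n T (lowerIndex n (i - 1) k) (.lower (lowerIndex n (j + 1) k)) a ↔
          a = m i j := by
  obtain ⟨x, y, s, h⟩ := hT.exists_isVertexCoordinates hn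
  refine ⟨h.exists_frieze, fun m hm i j k hij a => ?_⟩
  -- Translation invariance removes `k`, and `i - 1 ≤ j + 1` removes the absolute value.
  rw [h.hasLabel_iff hn hT, lowerIndex, lowerIndex, h.vertexDet_add_mul,
    h.abs_vertexDet_of_le (by omega), ← h.eq_vertexDet hm (by omega)]
  exact Nat.cast_inj
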